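/- **Conventions.** All spaces are diffeological spaces, all maps are smooth in the sense of diffeology; subsets carry the subspace diffeology, products the product diffeology and sets $C^\infty(Y,X)$ of smooth maps the functional diffeology, unless stated otherwise. A diffeological space $X$ is *reflexive* if every parametrisation $P:U\to X$ such that $\varphi\circ P$ is smooth for all $\varphi\in C^\infty(X,\mathbb R)$ is a plot of $X$. Let $\pi:\mathbb R\to[0,1]$, $\pi(t)=\max\{0,\min\{1,t\}\}$, let $\mathbb I$ be the set $[0,1]$ with the quotient diffeology of $\mathbb R$ along $\pi$, and let $\mathrm{Path}(X)=\{u\in C^\infty(\mathbb R,X)\mid u\circ\pi=u\}$, with $\sigma(u)=u(0)$, $\tau(u)=u(1)$, and $\iota(x)$ the constant path at $x$. An *internal precategory* $(G,X)$ consists of smooth maps $\sigma,\tau:G\to X$ and $\iota:X\to G$ with $\sigma\iota=\tau\iota=1$; $G^n=G\times_X\cdots\times_XG$ is the space of strings $(g_1,\dots,g_n)$ with $\tau(g_i)=\sigma(g_{i+1})$. **Associahedra.** For $n\ge2$ let $\mathbb b_n=(0,\frac12,\dots,\frac12,\frac n2)\in\mathbb R^n$ (so $\mathbb b_2=(0,1)$).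 For $r,s\ge2$, $r+s=n+1$, $1\le k\le r$ let $$\partial_k\big((t_1,\dots,t_r),(u_1,\dots,u_s)\big)=(t_1,\dots,t_{k-1},u_1,\dots,u_{s-1},u_s+t_k,t_{k+1},\dots,t_r)$$ for $2\le k\le r$, and $\partial_1\big((t_1,\dots,t_r),(u_1,\dots,u_s)\big)=(u_1,\dots,u_{s-1},u_s+t_1,t_2,\dots,t_r)$. The non-empty cells of the cubic complexes $\mathbb K(n)$, $n\ge2$, and their characteristic maps $\pi_\kappa:\mathbb R^q\to\kappa\subset\mathbb R^n$ are defined inductively: the point $\mathbb b_n$ is a $0$-cell; if $\kappa_1,\kappa_2$ are cells of $\mathbb K(r),\mathbb K(s)$, then $\kappa=\partial_k(\kappa_1\times\kappa_2)$ is a cell of $\mathbb K(n)$ with $\pi_\kappa(x,y)=\partial_k(\pi_{\kappa_1}(x),\pi_{\kappa_2}(y))$, and so is the cone $\kappa*\mathbb b_n$, with $\pi_{\kappa*\mathbb b_n}(z,t)=(1-\pi(t))\,\pi_\kappa(z)+\pi(t)\,\mathbb b_n$. The polyhedron $|\mathbb K(n)|\subset\mathbb R^n$ is the union of these cells, with the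 finest diffeology for which all characteristic maps $\mathbb R^q\to|\mathbb K(n)|$ are smooth (the colimit of the cells). The $\partial_k$ restrict to maps $|\mathbb K(r)|\times|\mathbb K(s)|\to|\mathbb K(n)|$. **h-unital $A_\infty$-categories.** An internal precategory $(G,X)$ is an *internal smooth h-unital $A_\infty$-category* if it has an *$A_\infty$-form*, i.e. smooth maps $M_n:|\mathbb K(n)|\times G^n\to G$, $n\ge2$, such that * (0) $\sigma M_n(\rho;g_1,\dots,g_n)=\sigma(g_1)$ and $\tau M_n(\rho;g_1,\dots,g_n)=\tau(g_n)$; * (1) $M_n(\partial_k(\rho,\rho');g_1,\dots,g_n)=M_r(\rho;g_1,\dots,g_{k-1},M_s(\rho';g_k,\dots,g_{k+s-1}),g_{k+s},\dots,g_n)$ for all $r,s\ge2$, $r+s=n+1$, $1\le k\le r$, $\rho\in|\mathbb K(r)|$, $\rho'\in|\mathbb K(s)|$; * (2') the maps $g\mapsto M_2(\mathbb b_2;\iota\sigma(g),g)$ and $g\mapsto M_2(\mathbb b_2;g,\iota\tau(g))$ are each homotopic to the identity of $G$ through a smooth homotopy $\mathbb I\times G\to G$ that preserves $\sigma$ and $\tau$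 throughout. **Concatenations.** Let $E_n=\{(r_1,\dots,r_n)\in\mathbb R^n\mid r_i>0,\ \sum_i r_i=1\}$, $\mathbb e_n=\frac1n(1,\dots,1)\in E_n$, and $$\partial_k^E(x;y)=(x_1,\dots,x_{k-1},x_ky_1,\dots,x_ky_s,x_{k+1},\dots,x_r),\qquad x\in E_r,\ y\in E_s .$$ **Theorem.** Let $X$ be a reflexive diffeological space. Then composition with $\pi$ is a diffeomorphism $C^\infty(\mathbb I,X)\cong\mathrm{Path}(X)$, and $(\mathrm{Path}(X),X)$, with $\sigma,\tau,\iota$ as above, is an internal smooth h-unital $A_\infty$-category. More precisely: 1. for every $n\ge2$ there is a well-defined smooth map $\beta_n:E_n\times\mathrm{Path}(X)^n\to\mathrm{Path}(X)$ (equivalently, a smooth map $E_n\to C^\infty(\mathrm{Path}(X)^n,\mathrm{Path}(X))$) such that, with $v_i=r_1+\dots+r_i$, the path $v=\beta_n(r_1,\dots,r_n;u_1,\dots,u_n)$ satisfies $v(t)=u_i\big(\tfrac{t-v_{i-1}}{r_i}\big)$ for $v_{i-1}\le t\le v_i$, $1\le i\le n$, where the lower bound on $t$ is omitted for $i=1$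 and the upper bound is omitted for $i=n$; 2. there are smooth maps $\varphi_n:|\mathbb K(n)|\to E_n$, $n\ge2$, with $\varphi_n(\mathbb b_n)=\mathbb e_n$ and $\varphi_n\circ\partial_k=\partial_k^E\circ(\varphi_r\times\varphi_s)$ for all $r,s\ge2$, $r+s=n+1$, $1\le k\le r$; 3. the maps $M_n(\rho;u_1,\dots,u_n)=\beta_n(\varphi_n(\rho);u_1,\dots,u_n)$, $n\ge2$, form an $A_\infty$-form on $(\mathrm{Path}(X),X)$. -/

import Mathlib

open Diffeology
open scoped ContDiff

namespace AInfty

noncomputable section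

/-! ### Diffeological constructions -/

/-- The diffeology on `X` pulled back along `f : X → Y`: a map `p` is a plot iff `f ∘ p` is.
For injective `f` this is the subspace diffeology. -/
@[reducible]
def inducedDiffeology {X Y : Type*} [DiffeologicalSpace Y] (f : X → Y) :
    DiffeologicalSpace X where
  plots n := {p | IsPlot (f ∘ p)}
  constant_plots x := isPlot_const (x := f x)
  plot_reparam {_ _ p _} hp hf := isPlot_reparam (p := f ∘ p) hp hf
  locality hp := DiffeologicalSpace.locality fun x => by
    obtain ⟨u, hu, hx, h⟩ := hp x
    exact ⟨u, hu, hx, fun hfu hf => h hfu hf⟩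

/-- The pushforward of the diffeology of `L` along `f : L → Y`, i.e. the finest diffeology on `Y`
for which `f` is smooth. For surjective `f` this is the quotient diffeology and `f` is a
subduction. -/
@[reducible]
def pushforwardDiffeology {L Y : Type*} [DiffeologicalSpace L] (f : L → Y) :
    DiffeologicalSpace Y :=
  DiffeologicalSpace.generateFrom
    {P | ∃ (n : ℕ) (p : EuclideanSpace ℝ (Fin n) → L), IsPlot p ∧ P = ⟨n, f ∘ p⟩}

/-- The product diffeology on a binary product. -/
instance instProd {X Y : Type*} [DiffeologicalSpace X] [DiffeologicalSpace Y] :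
    DiffeologicalSpace (X × Y) where
  plots n := {p | IsPlot (fun x => (p x).1) ∧ IsPlot (fun x => (p x).2)}
  constant_plots x := ⟨isPlot_const, isPlot_const⟩
  plot_reparam hp hf := ⟨isPlot_reparam hp.1 hf, isPlot_reparam hp.2 hf⟩
  locality hp := by
    constructor
    · refine DiffeologicalSpace.locality fun x => ?_
      obtain ⟨u, hu, hx, h⟩ := hp x
      exact ⟨u, hu, hx, fun hfu hf => (h hfu hf).1⟩
    · refine DiffeologicalSpace.locality fun x => ?_
      obtain ⟨u, hu, hx, h⟩ := hp x
      exact ⟨u, hu, hx, fun hfu hf => (h hfu hf).2⟩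

/-- The product diffeology on a product of a family. -/
instance instPi {ι : Type*} {X : ι → Type*} [∀ i, DiffeologicalSpace (X i)] :
    DiffeologicalSpace (∀ i, X i) where
  plots n := {p | ∀ i, IsPlot (fun x => p x i)}
  constant_plots x := fun _ => isPlot_const
  plot_reparam hp hf := fun i => isPlot_reparam (hp i) hf
  locality hp := fun i => DiffeologicalSpace.locality fun x => by
    obtain ⟨u, hu, hx, h⟩ := hp x
    exact ⟨u, hu, hx, fun hfu hf => h hfu hf i⟩

/-- The set `C^∞(Y, X)` of smooth maps. -/
structure SmoothMap (Y X : Type*) [DiffeologicalSpace Y] [DiffeologicalSpace X] where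
  toFun : Y → X
  smooth : DSmooth toFun

/-- The functional diffeology on `C^∞(Y, X)`: a map `p : ℝⁿ → C^∞(Y, X)` is a plot iff its adjoint
`ℝⁿ × Y → X` is smooth. -/
instance instSmoothMap {Y X : Type*} [DiffeologicalSpace Y] [DiffeologicalSpace X] :
    DiffeologicalSpace (SmoothMap Y X) where
  plots n := {p | DSmooth (fun z : EuclideanSpace ℝ (Fin n) × Y => (p z.1).toFun z.2)}
  constant_plots x := fun m q hq => x.smooth m (fun y => (q y).2) hq.2
  plot_reparam {n m p f} hp hf := fun l q hq =>
    hp l (fun y => (f (q y).1, (q y).2)) ⟨(hf.comp hq.1.contDiff).isPlot, hq.2⟩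
  locality {n p} hp := fun m q hq => DiffeologicalSpace.locality fun x => by
    have hc : ContDiff ℝ ∞ (fun y => (q y).1) := hq.1.contDiff
    obtain ⟨u, hu, hx, h⟩ := hp (q x).1
    refine ⟨(fun y => (q y).1) ⁻¹' u, hu.preimage hc.continuous, hx, ?_⟩
    intro l f hfu hf
    exact h hfu (hc.comp hf) l (fun y => (y, (q (f y)).2))
      ⟨isPlot_id, isPlot_reparam (p := fun y => (q y).2) hq.2 hf⟩

/-- A diffeomorphism: a smooth bijection with smooth inverse. -/
def IsDiffeomorphism {X Y : Type*} [DiffeologicalSpace X] [DiffeologicalSpace Y]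
    (f : X → Y) : Prop :=
  DSmooth f ∧ ∃ g : Y → X, DSmooth g ∧ Function.LeftInverse g f ∧ Function.RightInverse g f

/-- A diffeological space is reflexive if every parametrisation `p` such that `φ ∘ p` is smooth
for all smooth `φ : X → ℝ` is a plot. -/
def IsReflexive (X : Type*) [DiffeologicalSpace X] : Prop :=
  ∀ (n : ℕ) (p : EuclideanSpace ℝ (Fin n) → X),
    (∀ φ : X → ℝ, DSmooth φ → ContDiff ℝ ∞ (φ ∘ p)) → IsPlot p

/-! ### The interval `𝕀` and the path space -/

/-- The continuous idempotent `t ↦ max 0 (min 1 t)` of `ℝ`. -/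
def clamp (t : ℝ) : ℝ := max 0 (min 1 t)

/-- The underlying set `[0, 1]` of the diffeological interval `𝕀`. -/
structure Interval where
  val : ℝ
  nonneg : 0 ≤ val
  le_one : val ≤ 1

/-- The projection `ℝ → 𝕀` given by `clamp`. -/
def Interval.proj (t : ℝ) : Interval :=
  ⟨clamp t, le_max_left _ _, max_le zero_le_one (min_le_left _ _)⟩

/-- `𝕀` carries the quotient diffeology of `ℝ` (not the subspace diffeology). -/
instance : DiffeologicalSpace Interval := pushforwardDiffeology Interval.proj

theorem Interval.dSmooth_proj : DSmooth Interval.proj := fun n p hp =>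
  DiffeologicalSpace.isPlot_generatedFrom_of_mem ⟨n, p, hp, rfl⟩

/-- The path space: smooth maps `u : ℝ → X` with `u ∘ clamp = u`. -/
structure PathSpace (X : Type*) [DiffeologicalSpace X] where
  toSmoothMap : SmoothMap ℝ X
  clamp_eq : ∀ t, toSmoothMap.toFun (clamp t) = toSmoothMap.toFun t

/-- The path space is a subspace of `C^∞(ℝ, X)`. -/
instance {X : Type*} [DiffeologicalSpace X] : DiffeologicalSpace (PathSpace X) :=
  inducedDiffeology PathSpace.toSmoothMap

instance {X : Type*} [DiffeologicalSpace X] : CoeFun (PathSpace X) (fun _ => ℝ → X) :=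
  ⟨fun u => u.toSmoothMap.toFun⟩

/-- The map `C^∞(𝕀, X) → PathSpace X` given by composition with the projection `ℝ → 𝕀`. -/
def PathSpace.ofInterval {X : Type*} [DiffeologicalSpace X] (u : SmoothMap Interval X) :
    PathSpace X where
  toSmoothMap := ⟨fun t => u.toFun (Interval.proj t), u.smooth.comp Interval.dSmooth_proj⟩
  clamp_eq t := by
    have : Interval.proj (clamp t) = Interval.proj t := by
      simp [Interval.proj, clamp]
    simp only [this]

/-! ### Internal precategories and strings of composable arrows -/

/-- An internal precategory in diffeological spaces. -/
structure InternalPrecategory (G X : Type*) [DiffeologicalSpace G] [DiffeologicalSpace X] where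
  source : G → X
  target : G → X
  unit : X → G
  dSmooth_source : DSmooth source
  dSmooth_target : DSmooth target
  dSmooth_unit : DSmooth unit
  source_unit : ∀ x, source (unit x) = x
  target_unit : ∀ x, target (unit x) = x

/-- The internal precategory `(PathSpace X, X)` with `σ(u) = u(0)`, `τ(u) = u(1)` and `ι(x)` the
constant path at `x`. -/
def pathPrecategory (X : Type*) [DiffeologicalSpace X] :
    InternalPrecategory (PathSpace X) X where
  source u := u 0
  target u := u 1
  unit x := ⟨⟨fun _ => x, dSmooth_const⟩, fun _ => rfl⟩
  dSmooth_source n _ hp := hp n (fun y => (y, (0 : ℝ))) ⟨isPlot_id, isPlot_const⟩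
  dSmooth_target n _ hp := hp n (fun y => (y, (1 : ℝ))) ⟨isPlot_id, isPlot_const⟩
  dSmooth_unit _ _ hp := fun _ q hq => isPlot_reparam (f := fun y => (q y).1) hp hq.1.contDiff
  source_unit _ := rfl
  target_unit _ := rfl

section Strings

variable {G X : Type*} [DiffeologicalSpace G] [DiffeologicalSpace X]

/-- The iterated fibre product `G ×_X ⋯ ×_X G` (`n ≥ 1` factors): strings `(g₁, …, gₙ)` with
`τ(gᵢ) = σ(gᵢ₊₁)`. Positions are numbered from `0` in `Fin n`. -/
structure Composable (C : InternalPrecategory G X) (n : ℕ) where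
  arrow : Fin n → G
  composable : ∀ i j : Fin n, j.val = i.val + 1 → C.target (arrow i) = C.source (arrow j)

/-- The iterated fibre product is a subspace of the product. -/
instance (C : InternalPrecategory G X) (n : ℕ) : DiffeologicalSpace (Composable C n) :=
  inducedDiffeology Composable.arrow

/-- A composable pair. -/
def Composable.pair (C : InternalPrecategory G X) (f g : G) (h : C.target f = C.source g) :
    Composable C 2 where
  arrow := ![f, g]
  composable i j hij := by
    fin_cases i <;> fin_cases j <;> simp_all

/-- The substring of length `s` starting at position `k`. -/
def Composable.block {C : InternalPrecategory G X} {r s n : ℕ} (h : r + s = n + 1) (k : Fin r)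
    (g : Composable C n) : Composable C s where
  arrow j := g.arrow ⟨k.val + j.val, by omega⟩
  composable i j hij := g.composable _ _ (by simp only; omega)

/-- The string of length `r` obtained by replacing the substring of length `s` starting at
position `k` by a single arrow `m` with the same source and target. -/
def Composable.contract {C : InternalPrecategory G X} {r s n : ℕ} (h : r + s = n + 1)
    (hs : 2 ≤ s) (k : Fin r) (g : Composable C n) (m : G)
    (hsrc : C.source m = C.source (g.arrow ⟨k.val, by omega⟩))
    (htgt : C.target m = C.target (g.arrow ⟨k.val + (s - 1), by omega⟩)) : Composable C r where
  arrow j :=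
    if j.val < k.val then g.arrow ⟨j.val, by omega⟩
    else if j.val = k.val then m
    else g.arrow ⟨j.val + (s - 1), by omega⟩
  composable i j hij := by
    rcases lt_trichotomy i.val k.val with hi | hi | hi
    · by_cases hj : j.val < k.val
      · simp only [hi, hj, if_true]
        exact g.composable _ _ hij
      · have hjk : j.val = k.val := by omega
        simp only [hi, hjk, if_true, lt_irrefl, if_false]
        rw [hsrc]
        exact g.composable _ _ (by simp only; omega)
    · have h1 : ¬ i.val < k.val := by omega
      have h2 : ¬ j.val < k.val := by omega
      have h3 : ¬ j.val = k.val := by omega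
      simp only [h2, h3, hi, lt_irrefl, if_true, if_false]
      rw [htgt]
      exact g.composable _ _ (by simp only; omega)
    · have h1 : ¬ i.val < k.val := by omega
      have h2 : ¬ j.val < k.val := by omega
      have h3 : ¬ j.val = k.val := by omega
      have h4 : ¬ i.val = k.val := by omega
      simp only [h1, h2, h3, h4, if_false]
      exact g.composable _ _ (by simp only; omega)

end Strings

/-! ### Cubic cells and the associahedra -/

/-- A cubic cell in `ℝⁿ`: the cell is the image of its characteristic map `ℝ^q → ℝⁿ`, and its
diffeology is the pushforward along that map. -/
structure CubicCell (n : ℕ) where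
  dim : ℕ
  chart : EuclideanSpace ℝ (Fin dim) → (Fin n → ℝ)

namespace CubicCell

variable {n m : ℕ}

/-- The underlying subset of `ℝⁿ`. -/
def carrier (σ : CubicCell n) : Set (Fin n → ℝ) := Set.range σ.chart

/-- The `0`-cell at a point. -/
def point (p : Fin n → ℝ) : CubicCell n := ⟨0, fun _ => p⟩

/-- The image of a cell under a map (used for injective affine maps). -/
def map (f : (Fin n → ℝ) → (Fin m → ℝ)) (σ : CubicCell n) : CubicCell m :=
  ⟨σ.dim, fun x => f (σ.chart x)⟩

/-- The join `σ * τ = {(1 - t) x + t y}` of two cells in general position, with characteristic map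
`ℝ^q × ℝ × ℝ^q' → σ × 𝕀 × τ → σ * τ`. -/
def join (σ τ : CubicCell n) : CubicCell n where
  dim := σ.dim + 1 + τ.dim
  chart x :=
    let t := clamp (x (Fin.castAdd τ.dim (Fin.natAdd σ.dim 0)))
    (1 - t) • σ.chart (WithLp.toLp 2 fun i => x (Fin.castAdd τ.dim (Fin.castAdd 1 i))) +
      t • τ.chart (WithLp.toLp 2 fun i => x (Fin.natAdd (σ.dim + 1) i))

/-- The product `{x + y - a}` of two cells whose affine hulls meet in the single point `a`, with
characteristic map `ℝ^q × ℝ^q' → σ × τ`. -/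
def product (a : Fin n → ℝ) (σ τ : CubicCell n) : CubicCell n where
  dim := σ.dim + τ.dim
  chart x :=
    σ.chart (WithLp.toLp 2 fun i => x (Fin.castAdd τ.dim i)) +
      τ.chart (WithLp.toLp 2 fun i => x (Fin.natAdd σ.dim i)) - a

end CubicCell

/-- The point `𝕓ₙ = (0, 1/2, …, 1/2, n/2)`. -/
def center (n : ℕ) : Fin n → ℝ := fun j =>
  if j.val = 0 then 0 else if j.val + 1 = n then (n : ℝ) / 2 else 1 / 2

/-- The linear face operator
`∂ₖ(t, u) = (t₁, …, tₖ₋₁, u₁, …, uₛ₋₁, uₛ + tₖ, tₖ₊₁, …, tᵣ)`, `r + s = n + 1`, with positions and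
the index `k` numbered from `0`. -/
def faceMap {r s n : ℕ} (h : r + s = n + 1) (hs : 2 ≤ s) (k : Fin r)
    (t : Fin r → ℝ) (u : Fin s → ℝ) : Fin n → ℝ := fun j =>
  if h1 : j.val < k.val then t ⟨j.val, by omega⟩
  else if h2 : j.val < k.val + (s - 1) then u ⟨j.val - k.val, by omega⟩
  else if j.val = k.val + (s - 1) then u ⟨s - 1, by omega⟩ + t k
  else t ⟨j.val - (s - 1), by omega⟩

/-- The product cell `∂ₖ(σ × {𝕓ₛ}) × ∂ₖ({𝕓ᵣ} × τ)`, whose underlying set is `∂ₖ(σ × τ)`. -/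
def faceCell {r s n : ℕ} (h : r + s = n + 1) (hs : 2 ≤ s) (k : Fin r)
    (σ : CubicCell r) (τ : CubicCell s) : CubicCell n :=
  CubicCell.product (faceMap h hs k (center r) (center s))
    (σ.map fun t => faceMap h hs k t (center s))
    (τ.map fun u => faceMap h hs k (center r) u)

/-- The non-empty cells of the cubic complex `𝕂(n)`: the cells of
`𝕂(n) = ⋃ 𝕃ₖ(r, s) * 𝕓ₙ`, where `𝕃ₖ(r, s)` consists of the product cells of `𝕂(r)` and `𝕂(s)`.
(A join with the empty cell is the other cell itself.) -/
inductive IsAssocCell : (n : ℕ) → CubicCell n → Prop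
  | center (n : ℕ) (hn : 2 ≤ n) : IsAssocCell n (CubicCell.point (center n))
  | face {r s n : ℕ} (h : r + s = n + 1) (hr : 2 ≤ r) (hs : 2 ≤ s) (k : Fin r)
      (σ : CubicCell r) (τ : CubicCell s) (hσ : IsAssocCell r σ) (hτ : IsAssocCell s τ) :
      IsAssocCell n (faceCell h hs k σ τ)
  | cone {r s n : ℕ} (h : r + s = n + 1) (hr : 2 ≤ r) (hs : 2 ≤ s) (k : Fin r)
      (σ : CubicCell r) (τ : CubicCell s) (hσ : IsAssocCell r σ) (hτ : IsAssocCell s τ) :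
      IsAssocCell n ((faceCell h hs k σ τ).join (CubicCell.point (AInfty.center n)))

/-- The polyhedron `|𝕂(n)|`, `n ≥ 2`, as a set: the union of the cells of `𝕂(n)`. -/
structure Associahedron (n : ℕ) where
  val : Fin n → ℝ
  mem : ∃ σ, IsAssocCell n σ ∧ val ∈ σ.carrier

/-- The characteristic map of a cell of `𝕂(n)`, as a map to `|𝕂(n)|`. -/
def Associahedron.chart {n : ℕ} (σ : CubicCell n) (hσ : IsAssocCell n σ)
    (x : EuclideanSpace ℝ (Fin σ.dim)) : Associahedron n :=
  ⟨σ.chart x, σ, hσ, x, rfl⟩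

/-- The colimit diffeology on `|𝕂(n)|`: the finest one for which all inclusions of cells are
smooth, equivalently all characteristic maps are smooth. -/
instance (n : ℕ) : DiffeologicalSpace (Associahedron n) :=
  DiffeologicalSpace.generateFrom
    {P | ∃ (σ : CubicCell n) (hσ : IsAssocCell n σ), P = ⟨σ.dim, Associahedron.chart σ hσ⟩}

/-- The vertex `𝕓ₙ` of `|𝕂(n)|`. -/
def Associahedron.center (n : ℕ) (hn : 2 ≤ n) : Associahedron n :=
  Associahedron.chart _ (IsAssocCell.center n hn) 0

theorem faceCell_chart {r s n : ℕ} (h : r + s = n + 1) (hs : 2 ≤ s) (k : Fin r)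
    (σ : CubicCell r) (τ : CubicCell s) (x : EuclideanSpace ℝ (Fin (σ.dim + τ.dim))) :
    (faceCell h hs k σ τ).chart x =
      faceMap h hs k (σ.chart (WithLp.toLp 2 fun i => x (Fin.castAdd τ.dim i)))
        (τ.chart (WithLp.toLp 2 fun i => x (Fin.natAdd σ.dim i))) := by
  funext j
  simp only [faceCell, CubicCell.product, CubicCell.map, Pi.add_apply, Pi.sub_apply, faceMap]
  split_ifs <;> ring

/-- The face operator `∂ₖ : |𝕂(r)| × |𝕂(s)| → |𝕂(n)|`. -/
def Associahedron.face {r s n : ℕ} (h : r + s = n + 1) (hr : 2 ≤ r) (hs : 2 ≤ s) (k : Fin r)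
    (ρ : Associahedron r) (σ : Associahedron s) : Associahedron n where
  val := faceMap h hs k ρ.val σ.val
  mem := by
    obtain ⟨a, ha, x, hx⟩ := ρ.mem
    obtain ⟨b, hb, y, hy⟩ := σ.mem
    refine ⟨faceCell h hs k a b, IsAssocCell.face h hr hs k a b ha hb,
      WithLp.toLp 2 (Fin.append (fun i => x i) (fun i => y i)), ?_⟩
    refine (faceCell_chart h hs k a b _).trans ?_
    rw [← hx, ← hy]
    congr 2
    · ext i
      exact Fin.append_left _ _ _
    · ext i
      exact Fin.append_right _ _ _

/-! ### h-unital `A_∞`-categories -/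

section AInftyForms

variable {G X : Type*} [DiffeologicalSpace G] [DiffeologicalSpace X]

/-- Two maps `f g : G → G` are smoothly homotopic through maps preserving source and target. -/
def SmoothlyHomotopic (C : InternalPrecategory G X) (f g : G → G) : Prop :=
  ∃ H : Interval × G → G, DSmooth H ∧
    (∀ u, H (Interval.proj 0, u) = f u) ∧ (∀ u, H (Interval.proj 1, u) = g u) ∧
    ∀ t u, C.source (H (t, u)) = C.source u ∧ C.target (H (t, u)) = C.target u

/-- `M(n) : |𝕂(n)| × Gⁿ → G`, `n ≥ 2`, is a smooth h-unital `A_∞`-form on the internal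
precategory `C`. (`|𝕂(n)|` is empty for `n < 2`, so that only `n ≥ 2` matters.) -/
structure IsHUnitalAInftyForm (C : InternalPrecategory G X)
    (M : (n : ℕ) → Associahedron n × Composable C n → G) : Prop where
  smooth : ∀ n, 2 ≤ n → DSmooth (M n)
  source_eq : ∀ (n : ℕ) (hn : 2 ≤ n) (ρ : Associahedron n) (g : Composable C n),
    C.source (M n (ρ, g)) = C.source (g.arrow ⟨0, by omega⟩)
  target_eq : ∀ (n : ℕ) (hn : 2 ≤ n) (ρ : Associahedron n) (g : Composable C n),
    C.target (M n (ρ, g)) = C.target (g.arrow ⟨n - 1, by omega⟩)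
  assoc : ∀ (r s n : ℕ) (h : r + s = n + 1) (hr : 2 ≤ r) (hs : 2 ≤ s) (k : Fin r)
    (ρ : Associahedron r) (σ : Associahedron s) (g : Composable C n),
    M n (Associahedron.face h hr hs k ρ σ, g) =
      M r (ρ, g.contract h hs k (M s (σ, g.block h k))
        (source_eq s hs σ (g.block h k)) (target_eq s hs σ (g.block h k)))
  left_unit : SmoothlyHomotopic C
    (fun u => M 2 (Associahedron.center 2 le_rfl,
      Composable.pair C (C.unit (C.source u)) u (C.target_unit _))) id
  right_unit : SmoothlyHomotopic C
    (fun u => M 2 (Associahedron.center 2 le_rfl,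
      Composable.pair C u (C.unit (C.target u)) (C.source_unit _).symm)) id

end AInftyForms

/-! ### The space of concatenations -/

/-- The open simplex `Eₙ = {(r₁, …, rₙ) | rᵢ > 0, r₁ + ⋯ + rₙ = 1}`. -/
structure OpenSimplex (n : ℕ) where
  val : Fin n → ℝ
  pos : ∀ i, 0 < val i
  sum_eq : ∑ i, val i = 1

/-- `Eₙ` is a subspace of `ℝⁿ`. -/
instance (n : ℕ) : DiffeologicalSpace (OpenSimplex n) := inducedDiffeology OpenSimplex.val

/-- The barycentre `(1/n, …, 1/n)` of `Eₙ`. -/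
def OpenSimplex.barycenter (n : ℕ) (hn : 2 ≤ n) : OpenSimplex n where
  val _ := 1 / (n : ℝ)
  pos _ := by
    have : (0 : ℝ) < n := by exact_mod_cast (by omega : 0 < n)
    positivity
  sum_eq := by
    have : (n : ℝ) ≠ 0 := by exact_mod_cast (by omega : n ≠ 0)
    simp [this]

/-- `∂ₖ^E(x, y) = (x₁, …, xₖ₋₁, xₖ y₁, …, xₖ yₛ, xₖ₊₁, …, xᵣ)`, with positions and the index `k`
numbered from `0`. -/
def simplexFaceMap {r s n : ℕ} (h : r + s = n + 1) (hs : 2 ≤ s) (k : Fin r)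
    (x : Fin r → ℝ) (y : Fin s → ℝ) : Fin n → ℝ := fun j =>
  if h1 : j.val < k.val then x ⟨j.val, by omega⟩
  else if h2 : j.val < k.val + s then x k * y ⟨j.val - k.val, by omega⟩
  else x ⟨j.val - (s - 1), by omega⟩

/-- The path `v` is the concatenation of `u₁, …, uₙ` with lengths `r₁, …, rₙ`: on the `i`-th
subinterval `[vᵢ₋₁, vᵢ]`, `vᵢ = r₁ + ⋯ + rᵢ`, one has `v(t) = uᵢ((t - vᵢ₋₁) / rᵢ)`; the first
subinterval is extended to `-∞` and the last one to `∞`. -/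
def IsConcatenation {X : Type*} [DiffeologicalSpace X] {n : ℕ} (r : OpenSimplex n)
    (u : Composable (pathPrecategory X) n) (v : PathSpace X) : Prop :=
  ∀ (i : Fin n) (t : ℝ),
    (i.val = 0 ∨ ∑ j ∈ Finset.univ.filter (fun j => j < i), r.val j ≤ t) →
    (i.val + 1 = n ∨ t ≤ ∑ j ∈ Finset.univ.filter (fun j => j ≤ i), r.val j) →
    v t = u.arrow i ((t - ∑ j ∈ Finset.univ.filter (fun j => j < i), r.val j) / r.val i)

end

end AInfty

open AInfty

namespace AInfty

noncomputable section

/-! ### Partial sums and grafting of sequences -/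

/-! The theorem splits into a combinatorial part about `|𝕂(n)|` and an analytic part about paths.

Combinatorics. All points of `|𝕂(n)|` lie in the polytope `InPolytope`. It is star-shaped about
`𝕓ₙ`: every other point lies on a segment from a boundary point to the centre
(`InPolytope.exists_cone`), with a parameter that the point determines
(`OnBoundary.coneParameter_le`). The boundary is covered by the images of the `∂ₖ`, which are cut
out by inequalities on the partial sums in the block `[k, k + s)` (`IsBlock.exists_eq_graft`,
`OnBoundary.exists_isBlock`). Hence the value at the centre, multiplicativity on faces and
interpolation along cones prescribe the maps to `Eₙ` recursively. The recursion is stated as a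
relation, `SimplexGraph`, and the point is that the relation is single-valued
(`SimplexGraph.unique`). A boundary point may lie on two faces, but their blocks cannot cross
(`IsBlock.not_crossing`). They are therefore disjoint or nested, the point is a double graft in two
ways, and the corresponding associativity law for `∂ₖ^E` identifies the two values. The cone
parameter is passed through `Real.smoothTransition`, which absorbs the non-smooth `clamp`; along
each characteristic map the value is thus a smooth function (`IsAssocCell.exists_contDiff`).

Analysis. Paths are constant outside `[0, 1]`, so for a real function `φ` on `X` the composite of
`φ` with a concatenation is a telescoping sum of increments of `φ` along the rescaled paths
(`comp_concat`). For smooth `φ` this sum has no case distinctions and is smooth in lengths, paths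
and time together; reflexivity turns this into smoothness of concatenation (`isPlot_concat`). A
concatenation is determined by its values on the pieces, so the `A_∞` relation only requires that a
nested concatenation is a concatenation with lengths `∂ₖ^E` (`isConcatenation_contract`). Unitality
is a linear reparametrisation (`smoothlyHomotopic_squeeze`). -/

/-- The partial sums of a sequence. -/
def psum (x : ℕ → ℝ) (j : ℕ) : ℝ := ∑ i ∈ Finset.range j, x i

@[simp] theorem psum_zero (x : ℕ → ℝ) : psum x 0 = 0 := rfl

theorem psum_succ (x : ℕ → ℝ) (j : ℕ) : psum x (j + 1) = psum x j + x j :=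
  Finset.sum_range_succ x j

theorem psum_congr {x y : ℕ → ℝ} {j : ℕ} (h : ∀ i < j, x i = y i) : psum x j = psum y j :=
  Finset.sum_congr rfl fun i hi => h i (Finset.mem_range.1 hi)

theorem psum_combination (a b : ℝ) (x y : ℕ → ℝ) (j : ℕ) :
    psum (a • x + b • y) j = a * psum x j + b * psum y j := by
  simp [psum, Finset.sum_add_distrib, Finset.mul_sum]

theorem psum_mono {x : ℕ → ℝ} (hx : ∀ j, 0 ≤ x j) {i j : ℕ} (h : i ≤ j) : psum x i ≤ psum x j :=
  Finset.sum_le_sum_of_subset_of_nonneg (Finset.range_mono h) fun k _ _ => hx k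

theorem eq_of_psum_eq {n : ℕ} {x y : ℕ → ℝ} (hx : ∀ j, n ≤ j → x j = 0)
    (hy : ∀ j, n ≤ j → y j = 0) (h : ∀ j ≤ n, psum x j = psum y j) : x = y := by
  funext j
  by_cases hj : j < n
  · have h1 := h (j + 1) hj
    rw [psum_succ, psum_succ, h j hj.le] at h1
    linarith
  · rw [hx j (by omega), hy j (by omega)]

/-- The face operator `∂ₖ` on sequences; `u` is regarded as a sequence of length `s`. -/
def graft (k s : ℕ) (t u : ℕ → ℝ) : ℕ → ℝ := fun j =>
  if j < k then t j
  else if j < k + (s - 1) then u (j - k)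
  else if j = k + (s - 1) then u (s - 1) + t k
  else t (j - (s - 1))

/-- The face operator `∂ₖ^E` on sequences; `y` is regarded as a sequence of length `s`. -/
def scaledGraft (k s : ℕ) (x y : ℕ → ℝ) : ℕ → ℝ := fun j =>
  if j < k then x j
  else if j < k + s then x k * y (j - k)
  else x (j - (s - 1))

section Graft

variable {k s : ℕ} {t u : ℕ → ℝ}

theorem psum_graft_left {j : ℕ} (hj : j ≤ k) : psum (graft k s t u) j = psum t j :=
  psum_congr fun i hi => by simp [graft, show i < k by omega]

/-- The bound is strict because the last entry of the block also carries `t k`, which enters the sum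
only at `i = s`. -/
theorem psum_graft_mid {i : ℕ} (hi : i < s) :
    psum (graft k s t u) (k + i) = psum t k + psum u i := by
  induction i with
  | zero => simp [psum_graft_left]
  | succ i ih =>
    rw [← add_assoc, psum_succ, ih (by omega), psum_succ, graft, if_neg (by omega),
      if_pos (by omega), Nat.add_sub_cancel_left, add_assoc]

theorem psum_graft_right (hs : 1 ≤ s) (i : ℕ) :
    psum (graft k s t u) (k + s + i) = psum t (k + 1 + i) + psum u s := by
  induction i with
  | zero =>
    obtain ⟨s, rfl⟩ : ∃ m, s = m + 1 := ⟨s - 1, by omega⟩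
    rw [add_zero, add_zero, ← add_assoc, psum_succ, psum_graft_mid (by omega), psum_succ,
      psum_succ]
    simp [graft]
    ring
  | succ i ih =>
    rw [← add_assoc, psum_succ, ih, ← add_assoc, psum_succ, graft, if_neg (by omega),
      if_neg (by omega), if_neg (by omega), show k + s + i - (s - 1) = k + 1 + i by omega]
    ring

theorem psum_scaledGraft_left {j : ℕ} (hj : j ≤ k) :
    psum (scaledGraft k s t u) j = psum t j :=
  psum_congr fun i hi => by simp [scaledGraft, show i < k by omega]

theorem psum_scaledGraft_mid {i : ℕ} (hi : i ≤ s) :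
    psum (scaledGraft k s t u) (k + i) = psum t k + t k * psum u i := by
  induction i with
  | zero => simp [psum_scaledGraft_left]
  | succ i ih =>
    rw [← add_assoc, psum_succ, ih (by omega), psum_succ, scaledGraft, if_neg (by omega),
      if_pos (by omega), Nat.add_sub_cancel_left]
    ring

theorem psum_scaledGraft_right (hs : 1 ≤ s) (hu : psum u s = 1) (i : ℕ) :
    psum (scaledGraft k s t u) (k + s + i) = psum t (k + 1 + i) := by
  induction i with
  | zero => rw [add_zero, psum_scaledGraft_mid le_rfl, hu, add_zero, psum_succ, mul_one]
  | succ i ih =>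
    rw [← add_assoc, psum_succ, ih, ← add_assoc, psum_succ, scaledGraft, if_neg (by omega),
      if_neg (by omega), show k + s + i - (s - 1) = k + 1 + i by omega]

/-- Together with the disjoint case below, these are the operad associativity laws. They hold in the
same form for `graft` and `scaledGraft`, which lets values be compared by comparing points. -/
theorem graft_graft_nested {d p q : ℕ} {v : ℕ → ℝ} (hq : 1 ≤ q) (hp : d < p)
    (hpq : p + q = s + 1) :
    graft k s t (graft d q u v) = graft (k + d) q (graft k p t u) v := by
  funext j
  simp only [graft]
  grind (splits := 30)

theorem scaledGraft_scaledGraft_nested {d p q : ℕ} {v : ℕ → ℝ} (hq : 1 ≤ q) (hp : d < p)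
    (hpq : p + q = s + 1) :
    scaledGraft k s t (scaledGraft d q u v) = scaledGraft (k + d) q (scaledGraft k p t u) v := by
  funext j
  simp only [scaledGraft]
  grind (splits := 30)

theorem graft_graft_disjoint {d q : ℕ} {v : ℕ → ℝ} (hs : 1 ≤ s) (hq : 1 ≤ q) :
    graft k s (graft (k + 1 + d) q t v) u = graft (k + s + d) q (graft k s t u) v := by
  funext j
  simp only [graft]
  grind (splits := 30)

theorem scaledGraft_scaledGraft_disjoint {d q : ℕ} {v : ℕ → ℝ} (hs : 1 ≤ s) (hq : 1 ≤ q) :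
    scaledGraft k s (scaledGraft (k + 1 + d) q t v) u =
      scaledGraft (k + s + d) q (scaledGraft k s t u) v := by
  funext j
  simp only [scaledGraft]
  grind (splits := 30)

end Graft

/-! ### The polytope underlying the associahedron -/

/-- The sequences of length `n` forming the polytope `|𝕂(n)|`. -/
structure InPolytope (n : ℕ) (x : ℕ → ℝ) : Prop where
  nonneg : ∀ j, 0 ≤ x j
  psum_le : ∀ j, j < n → psum x (j + 1) ≤ j
  psum_eq : psum x n = n - 1
  eq_zero : ∀ j, n ≤ j → x j = 0

/-- The inequalities that hold on the face of the polytope given by the block `[k, k + s)`. -/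
structure IsBlock (k s : ℕ) (x : ℕ → ℝ) : Prop where
  psum_le : ∀ i, i + 1 < s → psum x (k + (i + 1)) - psum x k ≤ i
  le_psum : (s : ℝ) - 1 ≤ psum x (k + s) - psum x k

/-- A point of the polytope lies on its boundary if one of the defining inequalities is an
equality. -/
def OnBoundary (n : ℕ) (x : ℕ → ℝ) : Prop :=
  (∃ j, 1 ≤ j ∧ j + 1 < n ∧ x j = 0) ∨ ∃ j, 1 ≤ j ∧ j + 1 < n ∧ psum x (j + 1) = j

section Polytope

variable {r s n k : ℕ} {t u x : ℕ → ℝ}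

theorem InPolytope.graft (hr : 1 ≤ r) (hs : 1 ≤ s) (h : r + s = n + 1) (hk : k < r)
    (ht : InPolytope r t) (hu : InPolytope s u) : InPolytope n (graft k s t u) := by
  refine ⟨fun j => ?_, fun j hj => ?_, ?_, fun j hj => ?_⟩
  · rw [AInfty.graft]
    split_ifs
    exacts [ht.nonneg _, hu.nonneg _, add_nonneg (hu.nonneg _) (ht.nonneg _), ht.nonneg _]
  · rcases lt_or_ge j k with h1 | h1
    · rw [psum_graft_left h1]
      exact ht.psum_le j (by omega)
    · rcases lt_or_ge (j + 1) (k + s) with h2 | h2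
      · obtain ⟨i, rfl⟩ := Nat.exists_eq_add_of_le h1
        rw [add_assoc, psum_graft_mid (by omega)]
        have h3 := hu.psum_le i (by omega)
        have h4 : psum t k ≤ k := (psum_mono ht.nonneg k.le_succ).trans (ht.psum_le k hk)
        push_cast
        linarith
      · obtain ⟨i, hi⟩ := Nat.exists_eq_add_of_le h2
        rw [hi, psum_graft_right hs, hu.psum_eq, show k + 1 + i = k + i + 1 by ring]
        have h3 := ht.psum_le (k + i) (by omega)
        have h4 : (j : ℝ) + 1 = k + s + i := by exact_mod_cast hi
        push_cast at h3
        linarith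
  · obtain ⟨i, rfl⟩ : ∃ i, n = k + s + i := ⟨n - (k + s), by omega⟩
    rw [psum_graft_right hs, show k + 1 + i = r by omega, ht.psum_eq, hu.psum_eq]
    have h4 : (r : ℝ) + s = k + s + i + 1 := by exact_mod_cast h
    push_cast
    linarith
  · rw [AInfty.graft, if_neg (by omega), if_neg (by omega), if_neg (by omega),
      ht.eq_zero _ (by omega)]

theorem isBlock_graft (hs : 1 ≤ s) (ht : InPolytope r t) (hu : InPolytope s u) :
    IsBlock k s (graft k s t u) := by
  refine ⟨fun i hi => ?_, ?_⟩
  · rw [psum_graft_mid hi, psum_graft_left le_rfl]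
    linarith [hu.psum_le i (by omega)]
  · have h1 := psum_graft_right (k := k) (t := t) (u := u) hs 0
    rw [add_zero, add_zero, psum_succ] at h1
    rw [h1, psum_graft_left le_rfl, hu.psum_eq]
    linarith [ht.nonneg k]

/-- Converse of `isBlock_graft`. The sum of `u` must be `s - 1`, which dictates how the last entry
of the block splits: `u` receives what is missing to `s - 1`, and the excess of the block sum over
`s - 1` becomes `t k`. -/
theorem IsBlock.exists_eq_graft (hs : 2 ≤ s) (h : r + s = n + 1) (hk : k < r)
    (hx : InPolytope n x) (hb : IsBlock k s x) :
    ∃ t u, InPolytope r t ∧ InPolytope s u ∧ x = AInfty.graft k s t u := by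
  set t : ℕ → ℝ := fun i => if i < k then x i
    else if i = k then psum x (k + s) - psum x k - (s - 1) else x (i + (s - 1)) with ht
  set u : ℕ → ℝ := fun i => if i + 1 < s then x (k + i)
    else if i + 1 = s then s - 1 - (psum x (k + (s - 1)) - psum x k) else 0 with hu
  have hsucc : psum x (k + s) = psum x (k + (s - 1)) + x (k + (s - 1)) := by
    rw [← psum_succ]; congr 1; omega
  have hxe : x = AInfty.graft k s t u := by
    funext j
    simp only [AInfty.graft, ht, hu]
    rcases lt_or_ge j k with h1 | h1
    · simp [h1]
    rcases lt_trichotomy j (k + (s - 1)) with h2 | h2 | h2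
    · simp [h1.not_gt, h2, show j - k + 1 < s by omega, show k + (j - k) = j by omega]
    · subst h2
      simp only [hsucc]
      simp [show s - 1 + 1 = s by omega]
    · simp [h1.not_gt, h2.not_gt, h2.ne', show ¬ j - (s - 1) < k by omega,
        show ¬ j - (s - 1) = k by omega, show j - (s - 1) + (s - 1) = j by omega]
  have hpt : ∀ j ≤ k, psum t j = psum x j := fun j hj => by
    rw [hxe, psum_graft_left hj]
  have hpu : ∀ i < s, psum u i = psum x (k + i) - psum x k := fun i hi => by
    have := psum_graft_mid (k := k) (s := s) (t := t) (u := u) hi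
    rw [← hxe, hpt k le_rfl] at this
    linarith
  have hus : psum u s = s - 1 := by
    obtain ⟨m, hm⟩ : ∃ m, s = m + 1 := ⟨s - 1, by omega⟩
    have h1 : u m = s - 1 - (psum x (k + (s - 1)) - psum x k) := by
      simp only [hu]; rw [if_neg (by omega), if_pos (by omega)]
    have h2 := hpu m (by omega)
    rw [show s - 1 = m by omega] at h1
    have h3 := psum_succ u m
    rw [← hm] at h3
    linarith
  have hpt' : ∀ i, psum t (k + 1 + i) = psum x (k + s + i) - (s - 1) := fun i => by
    have := psum_graft_right (k := k) (t := t) (u := u) (show 1 ≤ s by omega) i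
    rw [← hxe, hus] at this
    linarith
  -- Used at `i = s - 1`, this makes the last entry of `u` non-negative.
  have hle : ∀ i, i < s → psum x (k + i) - psum x k ≤ s - 2 := fun i hi => by
    rcases i with _ | i
    · have : (2 : ℝ) ≤ s := by exact_mod_cast hs
      simp only [add_zero]; linarith
    · have h1 := hb.psum_le i hi
      have h2 : (i : ℝ) + 2 ≤ s := by exact_mod_cast hi
      linarith
  refine ⟨t, u, ⟨fun j => ?_, fun j hj => ?_, ?_, fun j hj => ?_⟩,
    ⟨fun j => ?_, fun j hj => ?_, hus, fun j hj => ?_⟩, hxe⟩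
  · simp only [ht]
    split_ifs
    exacts [hx.nonneg _, by linarith [hb.le_psum], hx.nonneg _]
  · rcases lt_or_ge j k with h1 | h1
    · rw [hpt _ h1]; exact hx.psum_le j (by omega)
    · obtain ⟨i, rfl⟩ := Nat.exists_eq_add_of_le h1
      rw [show k + i + 1 = k + 1 + i by ring, hpt']
      have h3 := hx.psum_le (k + (s - 1) + i) (by omega)
      rw [show k + (s - 1) + i + 1 = k + s + i by omega] at h3
      have h4 : ((k + (s - 1) + i : ℕ) : ℝ) + 1 = k + s + i := by
        exact_mod_cast (by omega : k + (s - 1) + i + 1 = k + s + i)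
      push_cast
      linarith
  · obtain ⟨i, rfl⟩ : ∃ i, r = k + 1 + i := ⟨r - (k + 1), by omega⟩
    rw [hpt', show k + s + i = n by omega, hx.psum_eq]
    have h4 : ((k + 1 + i : ℕ) : ℝ) + s = n + 1 := by exact_mod_cast h
    linarith
  · simp only [ht]
    rw [if_neg (by omega), if_neg (by omega), hx.eq_zero _ (by omega)]
  · simp only [hu]
    split_ifs
    exacts [hx.nonneg _, by linarith [hle (s - 1) (by omega)], le_rfl]
  · rcases lt_or_ge (j + 1) s with h1 | h1
    · rw [hpu _ h1]; exact hb.psum_le j h1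
    · rw [show j + 1 = s by omega, hus]
      have : (j : ℝ) + 1 = s := by exact_mod_cast (by omega : j + 1 = s)
      linarith
  · simp only [hu]
    rw [if_neg (by omega), if_neg (by omega)]

/-- The merged entry `u (s - 1) + t k` can be separated because the total of `u` is fixed by
membership in the polytope; all other partial sums are read off directly. -/
theorem graft_inj {t' u' : ℕ → ℝ} (hs : 1 ≤ s) (ht : InPolytope r t)
    (ht' : InPolytope r t') (hu : InPolytope s u) (hu' : InPolytope s u')
    (h : graft k s t u = graft k s t' u') : t = t' ∧ u = u' := by
  have h1 : ∀ j ≤ k, psum t j = psum t' j := fun j hj => by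
    rw [← psum_graft_left (s := s) (u := u) hj, h, psum_graft_left hj]
  have h2 : ∀ i < s, psum u i = psum u' i := fun i hi => by
    have h3 := psum_graft_mid (k := k) (t := t) (u := u) hi
    rw [h, psum_graft_mid hi, h1 k le_rfl] at h3
    linarith
  have h4 : ∀ i, psum t (k + 1 + i) = psum t' (k + 1 + i) := fun i => by
    have h3 := psum_graft_right (k := k) (t := t) (u := u) hs i
    rw [h, psum_graft_right hs, hu.psum_eq, hu'.psum_eq] at h3
    linarith
  refine ⟨eq_of_psum_eq ht.eq_zero ht'.eq_zero fun j _ => ?_,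
    eq_of_psum_eq hu.eq_zero hu'.eq_zero fun j hj => ?_⟩
  · rcases le_or_gt j k with h5 | h5
    · exact h1 j h5
    · obtain ⟨i, rfl⟩ := Nat.exists_eq_add_of_le h5
      exact h4 i
  · rcases hj.lt_or_eq with h5 | rfl
    · exact h2 j h5
    · rw [hu.psum_eq, hu'.psum_eq]

/-- If the inner block ends before the outer one, its inequalities restrict to `u` verbatim. If both
end together, the last entry is contaminated by `t k`, and the lower bound comes instead from the
total of `u` and the upper bound on `psum u d`. -/
theorem IsBlock.nested {d q : ℕ} (hq : 1 ≤ q)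
    (hu : InPolytope s u) (hdq : d + q ≤ s) (hb : IsBlock (k + d) q (AInfty.graft k s t u)) :
    IsBlock d q u := by
  have h0 := psum_graft_mid (k := k) (t := t) (u := u) (show d < s by omega)
  refine ⟨fun i hi => ?_, ?_⟩
  · have h1 := hb.psum_le i hi
    rw [h0, add_assoc, psum_graft_mid (by omega)] at h1
    linarith
  · rcases hdq.lt_or_eq with h2 | h2
    · have h1 := hb.le_psum
      rw [h0, add_assoc, psum_graft_mid h2] at h1
      linarith
    · rw [h2, hu.psum_eq]
      have h3 : (d : ℝ) + q = s := by exact_mod_cast h2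
      rcases d with _ | d
      · simp at h3 ⊢; linarith
      · have := hu.psum_le d (by omega)
        push_cast at h3
        linarith

theorem IsBlock.disjoint {d q : ℕ} (hs : 1 ≤ s)
    (hb : IsBlock (k + s + d) q (AInfty.graft k s t u)) : IsBlock (k + 1 + d) q t := by
  refine ⟨fun i hi => ?_, ?_⟩
  · have h1 := hb.psum_le i hi
    rw [add_assoc (k + s), psum_graft_right hs, psum_graft_right hs, ← add_assoc] at h1
    linarith
  · have h1 := hb.le_psum
    rw [add_assoc (k + s), psum_graft_right hs, psum_graft_right hs, ← add_assoc] at h1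
    linarith

theorem IsBlock.not_crossing {k' s' : ℕ} (hb : IsBlock k s x) (hb' : IsBlock k' s' x)
    (h1 : k < k') (h2 : k' < k + s) : k' + s' ≤ k + s := by
  by_contra! h3
  -- Crossing blocks overlap in `[k', k + s)`. The initial part of the first block sums to at most
  -- `i` and the overlap to at most `j`, in total `s - 2`, whereas the first block sums to at least
  -- `s - 1`.
  obtain ⟨i, rfl⟩ : ∃ i, k' = k + (i + 1) := ⟨k' - k - 1, by omega⟩
  obtain ⟨j, rfl⟩ : ∃ j, s = i + 1 + (j + 1) := ⟨s - (i + 1) - 1, by omega⟩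
  have h4 := hb.psum_le i (by omega)
  have h5 := hb.le_psum
  have h6 := hb'.psum_le j (by omega)
  rw [add_assoc] at h6
  push_cast at h5
  linarith

/-- A block starting at `0` makes an upper bound tight; any other block forces its first entry to
vanish. -/
theorem IsBlock.onBoundary (hr : 2 ≤ r) (hs : 2 ≤ s) (h : r + s = n + 1) (hk : k < r)
    (hx : InPolytope n x) (hb : IsBlock k s x) : OnBoundary n x := by
  rcases Nat.eq_zero_or_pos k with rfl | hk0
  · refine Or.inr ⟨s - 1, by omega, by omega, le_antisymm (hx.psum_le _ (by omega)) ?_⟩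
    have h1 := hb.le_psum
    rw [show s - 1 + 1 = s by omega, Nat.cast_sub (by omega)]
    simpa using h1
  · refine Or.inl ⟨k, hk0, by omega, le_antisymm ?_ (hx.nonneg k)⟩
    have h1 := hb.psum_le 0 (by omega)
    rw [zero_add, psum_succ] at h1
    simpa using h1

theorem OnBoundary.exists_isBlock (hx : InPolytope n x) (hb : OnBoundary n x) :
    ∃ r s k, 2 ≤ r ∧ 2 ≤ s ∧ r + s = n + 1 ∧ k < r ∧ IsBlock k s x := by
  rcases hb with ⟨k, hk, hkn, h0⟩ | ⟨j, hj, hjn, h0⟩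
  · obtain ⟨m, rfl⟩ : ∃ m, k = m + 1 := ⟨k - 1, by omega⟩
    set k := m + 1 with hkm
    have hlast : 2 ≤ n - k ∧ ((n - k : ℕ) : ℝ) - 1 ≤ psum x (k + (n - k)) - psum x k := by
      refine ⟨by omega, ?_⟩
      rw [show k + (n - k) = n by omega, hx.psum_eq, Nat.cast_sub (by omega)]
      have := hx.psum_le m (by omega)
      rw [hkm]
      push_cast
      linarith
    -- With `x k = 0`, take the shortest block from `k` whose sum reaches its length minus one. The
    -- tail up to `n` qualifies, and minimality gives the upper bounds on the shorter sums.
    have hex : ∃ s : ℕ, 2 ≤ s ∧ (s : ℝ) - 1 ≤ psum x (k + s) - psum x k := ⟨_, hlast⟩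
    classical
    have hmin : ∀ s' : ℕ, 2 ≤ s' → s' < Nat.find hex →
        psum x (k + s') - psum x k < s' - 1 := fun s' h2 hlt =>
      not_le.1 fun h3 => Nat.find_min hex hlt ⟨h2, h3⟩
    have hle : Nat.find hex ≤ n - k := Nat.find_min' hex hlast
    obtain ⟨hs2, hs⟩ := Nat.find_spec hex
    refine ⟨n + 1 - Nat.find hex, Nat.find hex, k, by omega, hs2, by omega, by omega,
      ⟨fun i hi => ?_, hs⟩⟩
    rcases Nat.eq_zero_or_pos i with rfl | hi0
    · rw [zero_add, psum_succ, h0]; simp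
    · have := hmin (i + 1) (by omega) hi
      push_cast at this
      linarith
  · refine ⟨n - j, j + 1, 0, by omega, by omega, by omega, by omega,
      ⟨fun i hi => ?_, ?_⟩⟩
    · simpa using hx.psum_le i (by omega)
    · simp [h0]

end Polytope

/-! ### Radial structure of the polytope -/

/-- The point `𝕓ₙ` as a sequence. -/
def centerSeq (n : ℕ) : ℕ → ℝ := fun j =>
  if j = 0 then 0 else if j + 1 = n then (n : ℝ) / 2 else if j < n then 1 / 2 else 0

/-- The barycentre of the simplex as a sequence. -/
def barycenterSeq (n : ℕ) : ℕ → ℝ := fun j => if j < n then 1 / (n : ℝ) else 0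

section Radial

variable {n : ℕ} {x y : ℕ → ℝ} {c c' : ℝ}

theorem centerSeq_inner {j : ℕ} (hj : 1 ≤ j) (hjn : j + 1 < n) : centerSeq n j = 1 / 2 := by
  rw [centerSeq, if_neg (by omega), if_neg (by omega), if_pos (by omega)]

theorem centerSeq_last (hn : 2 ≤ n) : centerSeq n (n - 1) = n / 2 := by
  rw [centerSeq, if_neg (by omega), if_pos (by omega)]

theorem psum_centerSeq {j : ℕ} (hj : j + 1 < n) : psum (centerSeq n) (j + 1) = j / 2 := by
  induction j with
  | zero => simp [psum_succ, centerSeq]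
  | succ j ih =>
    rw [psum_succ, ih (by omega), centerSeq_inner (by omega) hj]
    push_cast
    ring

theorem psum_centerSeq_self (hn : 2 ≤ n) : psum (centerSeq n) n = n - 1 := by
  obtain ⟨m, rfl⟩ : ∃ m, n = m + 1 + 1 := ⟨n - 2, by omega⟩
  have h := centerSeq_last hn
  rw [show m + 1 + 1 - 1 = m + 1 by omega] at h
  rw [psum_succ, psum_centerSeq (by omega), h]
  push_cast
  ring

theorem inPolytope_centerSeq (hn : 2 ≤ n) : InPolytope n (centerSeq n) := by
  refine ⟨fun j => ?_, fun j hj => ?_, psum_centerSeq_self hn, fun j hj => ?_⟩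
  · rw [centerSeq]; split_ifs <;> positivity
  · rcases (show j + 1 ≤ n from hj).lt_or_eq with h | h
    · rw [psum_centerSeq h]
      linarith [Nat.cast_nonneg (α := ℝ) j]
    · rw [h, psum_centerSeq_self hn, ← h]
      simp
  · rw [centerSeq, if_neg (by omega), if_neg (by omega), if_neg (by omega)]

theorem InPolytope.zero_eq (hn : 2 ≤ n) (hx : InPolytope n x) : x 0 = 0 := by
  have := hx.psum_le 0 (by omega)
  simp only [psum_succ, psum_zero, zero_add, Nat.cast_zero] at this
  exact le_antisymm this (hx.nonneg 0)

theorem InPolytope.combination (hx : InPolytope n x) (hy : InPolytope n y) (h0 : 0 ≤ c)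
    (h1 : c ≤ 1) : InPolytope n ((1 - c) • x + c • y) := by
  refine ⟨fun j => ?_, fun j hj => ?_, ?_, fun j hj => ?_⟩
  · exact add_nonneg (mul_nonneg (by linarith) (hx.nonneg j)) (mul_nonneg h0 (hy.nonneg j))
  · rw [psum_combination]
    nlinarith [hx.psum_le j hj, hy.psum_le j hj]
  · rw [psum_combination, hx.psum_eq, hy.psum_eq]
    ring
  · simp [hx.eq_zero j hj, hy.eq_zero j hj]

/-- At the inequality that is tight for `x`, the centre has positive slack. The slack of the left
side is `c` times it, that of the right side at least `c'` times it. -/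
theorem OnBoundary.coneParameter_le (hx : OnBoundary n x) (hy : InPolytope n y) (hc : c' ≤ 1)
    (h : (1 - c) • x + c • centerSeq n = (1 - c') • y + c' • centerSeq n) : c' ≤ c := by
  rcases hx with ⟨j, hj, hjn, h0⟩ | ⟨j, hj, hjn, h0⟩
  · have h1 := congrFun h j
    simp only [Pi.add_apply, Pi.smul_apply, smul_eq_mul, h0, centerSeq_inner hj hjn] at h1
    nlinarith [hy.nonneg j]
  · have h1 := congrArg (fun z => psum z (j + 1)) h
    simp only [psum_combination, h0, psum_centerSeq hjn] at h1
    have h2 : (1 : ℝ) ≤ j := by exact_mod_cast hj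
    have h3 : (1 - c') * psum y (j + 1) ≤ (1 - c') * j :=
      mul_le_mul_of_nonneg_left (hy.psum_le j (by omega)) (by linarith)
    nlinarith

theorem eq_centerSeq (hn : 2 ≤ n) (hx : InPolytope n x)
    (h : ∀ j, 1 ≤ j → j + 1 < n → 1 / 2 ≤ x j ∧ psum x (j + 1) ≤ j / 2) : x = centerSeq n := by
  have hlow : ∀ j, j + 1 < n → (j : ℝ) / 2 ≤ psum x (j + 1) := fun j hj => by
    induction j with
    | zero => simpa [psum_succ] using hx.nonneg 0
    | succ j ih =>
      have h1 := ih (by omega)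
      have h2 := (h (j + 1) (by omega) hj).1
      rw [psum_succ]
      push_cast
      linarith
  refine eq_of_psum_eq hx.eq_zero (inPolytope_centerSeq hn).eq_zero fun j hj => ?_
  rcases j with _ | j
  · simp
  rcases hj.lt_or_eq with h1 | h1
  · rw [psum_centerSeq h1]
    rcases Nat.eq_zero_or_pos j with rfl | h2
    · simp [psum_succ, hx.zero_eq hn]
    · exact le_antisymm (h j h2 h1).2 (hlow j h1)
  · rw [h1, hx.psum_eq, psum_centerSeq_self hn]

theorem InPolytope.exists_cone (hn : 2 ≤ n) (hx : InPolytope n x) (hxc : x ≠ centerSeq n) :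
    ∃ y, ∃ c : ℝ, 0 ≤ c ∧ c ≤ 1 ∧ InPolytope n y ∧ OnBoundary n y ∧
      x = (1 - c) • y + c • centerSeq n := by
  -- For `n = 2` there are no such indices and the polytope is the single point `𝕓₂`.
  have hne : (Finset.Ico 1 (n - 1)).Nonempty := by
    by_contra hemp
    refine hxc (eq_centerSeq hn hx fun j hj hjn => absurd ⟨j, ?_⟩ hemp)
    simp only [Finset.mem_Ico]
    omega
  obtain ⟨m, hm, hmin⟩ := Finset.exists_min_image _
    (fun j => min (2 * x j) (2 * (j - psum x (j + 1)) / j)) hne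
  -- The largest `c` for which `(x - c 𝕓ₙ) / (1 - c)` satisfies all inequalities with `1 ≤ j`, `j +
  -- 1 < n`. The factor `2` arises because the centre has slack `1/2` in `x j` and `j/2` in the
  -- partial sum.
  set c := min (2 * x m) (2 * (m - psum x (m + 1)) / m) with hc
  have hm1 : 1 ≤ m := (Finset.mem_Ico.1 hm).1
  have hm2 : m + 1 < n := by have := (Finset.mem_Ico.1 hm).2; omega
  have hle : ∀ j, 1 ≤ j → j + 1 < n → c ≤ 2 * x j ∧ c * j ≤ 2 * (j - psum x (j + 1)) :=
    fun j hj hjn => by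
    have h1 := hmin j (Finset.mem_Ico.2 ⟨hj, by omega⟩)
    have h2 : (0 : ℝ) < j := by exact_mod_cast hj
    exact ⟨h1.trans (min_le_left _ _), (le_div_iff₀ h2).1 (h1.trans (min_le_right _ _))⟩
  have hm0 : (0 : ℝ) < m := by exact_mod_cast hm1
  have hc0 : 0 ≤ c := by
    have := hx.psum_le m (by omega)
    exact le_min (by linarith [hx.nonneg m]) (div_nonneg (by linarith) hm0.le)
  have hc1 : c < 1 := by
    by_contra! hc1
    refine hxc (eq_centerSeq hn hx fun j hj hjn => ?_)
    obtain ⟨h1, h2⟩ := hle j hj hjn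
    have h3 : (1 : ℝ) ≤ j := by exact_mod_cast hj
    exact ⟨by linarith, by nlinarith⟩
  have hd : 0 < 1 - c := by linarith
  have hdne := hd.ne'
  set y := (1 - c)⁻¹ • x + (-(c / (1 - c))) • centerSeq n with hy
  have hxy : x = (1 - c) • y + c • centerSeq n := by
    funext j
    simp only [hy, Pi.add_apply, Pi.smul_apply, smul_eq_mul]
    field_simp
    ring
  have hyj : ∀ j, (1 - c) * y j = x j - c * centerSeq n j := fun j => by
    have := congrFun hxy j
    simp only [Pi.add_apply, Pi.smul_apply, smul_eq_mul] at this
    linarith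
  have hyp : ∀ j, (1 - c) * psum y j = psum x j - c * psum (centerSeq n) j := fun j => by
    have := congrArg (fun z => psum z j) hxy
    simp only [psum_combination] at this
    linarith
  have hyn : psum y n = n - 1 := by
    have := hyp n
    rw [hx.psum_eq, psum_centerSeq_self hn] at this
    exact mul_left_cancel₀ hdne (by linarith)
  have hyle : ∀ j, j + 1 < n → psum y (j + 1) ≤ j := fun j hj => by
    have h1 := hyp (j + 1)
    rw [psum_centerSeq hj] at h1
    refine le_of_mul_le_mul_left ?_ hd
    rcases Nat.eq_zero_or_pos j with rfl | h2
    · rw [h1, psum_succ, hx.zero_eq hn]; simp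
    · linarith [(hle j h2 hj).2]
  refine ⟨y, c, hc0, hc1.le, ⟨fun j => ?_, fun j hj => ?_, hyn, fun j hj => ?_⟩, ?_, hxy⟩
  · rcases Nat.eq_zero_or_pos j with rfl | h2
    · refine nonneg_of_mul_nonneg_right (a := 1 - c) (b := y 0) ?_ hd
      rw [hyj, hx.zero_eq hn]; simp [centerSeq]
    rcases lt_trichotomy (j + 1) n with h1 | h1 | h1
    · refine nonneg_of_mul_nonneg_right (a := 1 - c) ?_ hd
      rw [hyj, centerSeq_inner h2 h1]
      linarith [(hle j h2 h1).1]
    -- The last entry does not enter the minimum; it is positive since the total is `n - 1` and the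
    -- preceding partial sum at most `n - 2`.
    · obtain ⟨i, rfl⟩ : ∃ i, j = i + 1 := ⟨j - 1, by omega⟩
      have h3 := hyle i (by omega)
      have h4 := psum_succ y (i + 1)
      rw [h1, hyn, ← h1] at h4
      push_cast at h4
      linarith
    · refine nonneg_of_mul_nonneg_right (a := 1 - c) ?_ hd
      rw [hyj, hx.eq_zero j (by omega), (inPolytope_centerSeq hn).eq_zero j (by omega)]
      simp
  · rcases (show j + 1 ≤ n from hj).lt_or_eq with h1 | h1
    · exact hyle j h1
    · rw [h1, hyn, ← h1]; simp
  · have := hyj j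
    rw [hx.eq_zero j hj, (inPolytope_centerSeq hn).eq_zero j hj] at this
    simpa [hdne] using this
  -- Whichever term attains the minimum at `m` becomes an equality for `y`.
  · rcases min_choice (2 * x m) (2 * (m - psum x (m + 1)) / m) with h1 | h1
    · refine Or.inl ⟨m, hm1, hm2, ?_⟩
      have h2 := hyj m
      rw [centerSeq_inner hm1 hm2] at h2
      refine mul_left_cancel₀ hdne ?_
      rw [h2, mul_zero]
      linarith [hc.trans h1]
    · refine Or.inr ⟨m, hm1, hm2, ?_⟩
      have h2 := hyp (m + 1)
      rw [psum_centerSeq hm2] at h2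
      have h3 : c * m = 2 * (m - psum x (m + 1)) := by
        rw [hc.trans h1]; field_simp
      refine mul_left_cancel₀ hdne ?_
      rw [h2]
      linarith

end Radial

/-! ### The graph of the maps `|𝕂(n)| → Eₙ` -/

/-- The graph of the multiplicative family of maps `|𝕂(n)| → Eₙ` that sends the centre to the
barycentre and interpolates smoothly along the cones. -/
inductive SimplexGraph : ℕ → (ℕ → ℝ) → (ℕ → ℝ) → Prop
  | center {n : ℕ} (hn : 2 ≤ n) : SimplexGraph n (centerSeq n) (barycenterSeq n)
  | cone {r s n k : ℕ} {t u a b : ℕ → ℝ} {c : ℝ} (h : r + s = n + 1) (hr : 2 ≤ r) (hs : 2 ≤ s)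
      (hk : k < r) (ht : SimplexGraph r t a) (hu : SimplexGraph s u b) (h0 : 0 ≤ c) (h1 : c ≤ 1) :
      SimplexGraph n ((1 - c) • graft k s t u + c • centerSeq n)
        ((1 - Real.smoothTransition c) • scaledGraft k s a b +
          Real.smoothTransition c • barycenterSeq n)

namespace SimplexGraph

variable {r s n k : ℕ} {t u a b x : ℕ → ℝ}

/-- A face is the cone at parameter `0`, so the relation needs no separate constructor for faces. -/
theorem face (h : r + s = n + 1) (hr : 2 ≤ r) (hs : 2 ≤ s) (hk : k < r)
    (ht : SimplexGraph r t a) (hu : SimplexGraph s u b) :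
    SimplexGraph n (graft k s t u) (scaledGraft k s a b) := by
  simpa using cone h hr hs hk ht hu le_rfl zero_le_one

theorem inPolytope (hx : SimplexGraph n x a) : InPolytope n x := by
  induction hx with
  | center hn => exact inPolytope_centerSeq hn
  | cone h hr hs hk _ _ h0 h1 iht ihu =>
    exact (iht.graft (by omega) (by omega) h hk ihu).combination
      (inPolytope_centerSeq (by omega)) h0 h1

/-- Radial projection to the boundary followed by splitting along a block. It is needed for
uniqueness, where the pieces of a common refinement are only known to lie in the polytope. -/
theorem exists_of_inPolytope (hn : 2 ≤ n) (hx : InPolytope n x) : ∃ a, SimplexGraph n x a := by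
  induction n using Nat.strong_induction_on generalizing x with
  | _ n ih =>
    by_cases hxc : x = centerSeq n
    · exact ⟨_, hxc ▸ center hn⟩
    obtain ⟨y, c, h0, h1, hy, hyb, rfl⟩ := hx.exists_cone hn hxc
    obtain ⟨r, s, k, hr, hs, h, hk, hblock⟩ := hyb.exists_isBlock hy
    obtain ⟨t, u, ht, hu, rfl⟩ := hblock.exists_eq_graft hs h hk hy
    obtain ⟨a, ha⟩ := ih r (by omega) hr ht
    obtain ⟨b, hb⟩ := ih s (by omega) hs hu
    exact ⟨_, cone h hr hs hk ha hb h0 h1⟩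

theorem pos_sum_support (hx : SimplexGraph n x a) :
    (∀ j < n, 0 < a j) ∧ psum a n = 1 ∧ ∀ j, n ≤ j → a j = 0 := by
  have hbary : ∀ {n : ℕ}, 2 ≤ n → (∀ j < n, 0 < barycenterSeq n j) ∧
      psum (barycenterSeq n) n = 1 ∧ ∀ j, n ≤ j → barycenterSeq n j = 0 := fun {n} hn => by
    have h0 : (0 : ℝ) < n := by exact_mod_cast (by omega : 0 < n)
    refine ⟨fun j hj => ?_, ?_, fun j hj => if_neg (by omega)⟩
    · rw [barycenterSeq, if_pos hj]; positivity
    · have h1 : psum (barycenterSeq n) n = psum (fun _ => 1 / (n : ℝ)) n :=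
        psum_congr fun i hi => by rw [barycenterSeq, if_pos hi]
      rw [h1]
      simp [psum, h0.ne']
  induction hx with
  | center hn => exact hbary hn
  | @cone r s n k t u a b c h hr hs hk _ _ h0 h1 iht ihu =>
    obtain ⟨ap, as, az⟩ := iht
    obtain ⟨bp, bs, bz⟩ := ihu
    obtain ⟨ep, es, ez⟩ := hbary (n := n) (by omega)
    have l0 := Real.smoothTransition.nonneg c
    have l1 := Real.smoothTransition.le_one c
    refine ⟨fun j hj => ?_, ?_, fun j hj => ?_⟩
    · have hp : 0 < scaledGraft k s a b j := by
        rw [scaledGraft]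
        split_ifs
        exacts [ap _ (by omega), mul_pos (ap _ hk) (bp _ (by omega)), ap _ (by omega)]
      simp only [Pi.add_apply, Pi.smul_apply, smul_eq_mul]
      rcases l1.lt_or_eq with h2 | h2
      · exact add_pos_of_pos_of_nonneg (mul_pos (by linarith) hp) (mul_nonneg l0 (ep j hj).le)
      · rw [h2]; simpa using ep j hj
    · obtain ⟨i, rfl⟩ : ∃ i, n = k + s + i := ⟨n - (k + s), by omega⟩
      rw [psum_combination, es, psum_scaledGraft_right (by omega) bs,
        show k + 1 + i = r by omega, as]
      ring
    · have hz : scaledGraft k s a b j = 0 := by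
        rw [scaledGraft, if_neg (by omega), if_neg (by omega), az _ (by omega)]
      simp [hz, ez j hj]

/-- The core of well-definedness. The order hypothesis `hle` leaves two configurations: the second
block lies to the right of the first or inside it. Then `t` or `u`, respectively, splits along the
second block, and injectivity of `graft` matches the two double grafts factor by factor. -/
theorem scaledGraft_eq_of_lt {r' s' k' : ℕ} {t' u' a' b' : ℕ → ℝ}
    (ih : ∀ m < n, ∀ x a a', SimplexGraph m x a → SimplexGraph m x a' → a = a')
    (h : r + s = n + 1) (hr : 2 ≤ r) (hs : 2 ≤ s) (hk : k < r)
    (h' : r' + s' = n + 1) (hr' : 2 ≤ r') (hs' : 2 ≤ s') (hk' : k' < r')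
    (ht : SimplexGraph r t a) (hu : SimplexGraph s u b)
    (ht' : SimplexGraph r' t' a') (hu' : SimplexGraph s' u' b')
    (heq : graft k s t u = graft k' s' t' u') (hle : k < k' ∨ k = k' ∧ s' ≤ s) :
    scaledGraft k s a b = scaledGraft k' s' a' b' := by
  have qt := ht.inPolytope
  have qu := hu.inPolytope
  have qt' := ht'.inPolytope
  have qu' := hu'.inPolytope
  have hblock : IsBlock k s (graft k s t u) := isBlock_graft (by omega) qt qu
  have hblock' : IsBlock k' s' (graft k s t u) := heq ▸ isBlock_graft (by omega) qt' qu'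
  rcases le_or_gt (k + s) k' with hks | hks
  · obtain ⟨d, rfl⟩ := Nat.exists_eq_add_of_le hks
    obtain ⟨p, hp⟩ : ∃ p, p + s' = r + 1 := ⟨r + 1 - s', by omega⟩
    obtain ⟨w, v, qw, qv, rfl⟩ :=
      (hblock'.disjoint (by omega)).exists_eq_graft hs' hp (by omega) qt
    obtain ⟨α, hw⟩ := exists_of_inPolytope (by omega) qw
    obtain ⟨β, hv⟩ := exists_of_inPolytope hs' qv
    have hpr : p + s = r' + 1 := by omega
    have hwu := face hpr (by omega) hs (by omega : k < p) hw hu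
    rw [graft_graft_disjoint (by omega) (by omega)] at heq
    obtain ⟨rfl, rfl⟩ := graft_inj (by omega) hwu.inPolytope qt' qv qu' heq
    rw [ih _ (by omega) _ _ _ ht (face hp (by omega) hs' (by omega) hw hv),
      ih _ (by omega) _ _ _ ht' hwu, ih _ (by omega) _ _ _ hu' hv,
      scaledGraft_scaledGraft_disjoint (by omega) (by omega)]
  · have hnest : k ≤ k' ∧ k' + s' ≤ k + s := by
      rcases hle with h1 | ⟨rfl, h1⟩
      · exact ⟨h1.le, hblock.not_crossing hblock' h1 hks⟩
      · exact ⟨le_rfl, by omega⟩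
    obtain ⟨d, rfl⟩ := Nat.exists_eq_add_of_le hnest.1
    -- Equal blocks are treated apart, since the inner splitting would have `p = 1`, outside the
    -- range of the relation.
    by_cases hss : s' = s
    · subst hss
      obtain rfl : d = 0 := by omega
      obtain rfl : r = r' := by omega
      obtain ⟨rfl, rfl⟩ := graft_inj (by omega) qt qt' qu qu' heq
      rw [ih _ (by omega) _ _ _ ht ht', ih _ (by omega) _ _ _ hu hu', add_zero]
    obtain ⟨p, hp⟩ : ∃ p, p + s' = s + 1 := ⟨s + 1 - s', by omega⟩
    obtain ⟨w, v, qw, qv, rfl⟩ :=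
      (hblock'.nested (by omega) qu (by omega)).exists_eq_graft hs' hp (by omega) qu
    obtain ⟨α, hw⟩ := exists_of_inPolytope (by omega) qw
    obtain ⟨β, hv⟩ := exists_of_inPolytope hs' qv
    have hpr : r + p = r' + 1 := by omega
    have htw := face hpr hr (by omega) hk ht hw
    rw [graft_graft_nested (by omega) (by omega : d < p) hp] at heq
    obtain ⟨rfl, rfl⟩ := graft_inj (by omega) htw.inPolytope qt' qv qu' heq
    rw [ih _ (by omega) _ _ _ hu (face hp (by omega) hs' (by omega) hw hv),
      ih _ (by omega) _ _ _ ht' htw, ih _ (by omega) _ _ _ hu' hv,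
      scaledGraft_scaledGraft_nested (by omega) (by omega : d < p) hp]

theorem eq_center_or_cone (hx : SimplexGraph n x a) :
    (x = centerSeq n ∧ a = barycenterSeq n) ∨
    ∃ r s k t u b d c, r + s = n + 1 ∧ 2 ≤ r ∧ 2 ≤ s ∧ k < r ∧ SimplexGraph r t b ∧
      SimplexGraph s u d ∧ c ≤ 1 ∧ InPolytope n (graft k s t u) ∧ OnBoundary n (graft k s t u) ∧
      x = (1 - c) • graft k s t u + c • centerSeq n ∧
      a = (1 - Real.smoothTransition c) • scaledGraft k s b d +
        Real.smoothTransition c • barycenterSeq n := by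
  cases hx with
  | center hn => exact Or.inl ⟨rfl, rfl⟩
  | @cone r s _ k t u b d c h hr hs hk ht hu h0 h1 =>
    have hq := ht.inPolytope.graft (by omega) (by omega) h hk hu.inPolytope
    exact Or.inr ⟨r, s, k, t, u, b, d, c, h, hr, hs, hk, ht, hu, h1, hq,
      (isBlock_graft (by omega) ht.inPolytope hu.inPolytope).onBoundary hr hs h hk hq, rfl, rfl⟩

theorem unique {a' : ℕ → ℝ} (hx : SimplexGraph n x a) (hx' : SimplexGraph n x a') : a = a' := by
  induction n using Nat.strong_induction_on generalizing x a a' with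
  | _ n ih =>
    have hcenter : ∀ {a}, SimplexGraph n (centerSeq n) a → a = barycenterSeq n := fun ha => by
      obtain ⟨-, h⟩ | ⟨r, s, k, t, u, b, d, c, -, -, -, -, -, -, hc, hq, hbd, h1, rfl⟩ :=
        ha.eq_center_or_cone
      · exact h
      -- The centre is itself the cone point at parameter `1`, so any presentation of it as a cone
      -- over the boundary has `c = 1`.
      · have h2 : (1 : ℝ) ≤ c := hbd.coneParameter_le (c' := 1) hq le_rfl (by rw [← h1]; simp)
        simp [Real.smoothTransition.one_of_one_le h2]
    obtain ⟨rfl, rfl⟩ | ⟨r, s, k, t, u, b, d, c, h, hr, hs, hk, ht, hu, hc, hq, hbd, h1, rfl⟩ :=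
      hx.eq_center_or_cone
    · exact (hcenter hx').symm
    obtain ⟨rfl, rfl⟩ | ⟨r', s', k', t', u', b', d', c', h', hr', hs', hk', ht', hu', hc', hq',
      hbd', h1', rfl⟩ := hx'.eq_center_or_cone
    · exact hcenter hx
    have heq := h1.symm.trans h1'
    obtain rfl : c = c' := le_antisymm (hbd'.coneParameter_le hq hc heq.symm)
      (hbd.coneParameter_le hq' hc' heq)
    rcases hc.lt_or_eq with hc1 | rfl
    · have hg : graft k s t u = graft k' s' t' u' :=
        smul_right_injective _ (by linarith : 1 - c ≠ 0) (add_right_cancel heq)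
      have ih' : ∀ m < n, ∀ x a a', SimplexGraph m x a → SimplexGraph m x a' → a = a' :=
        fun m hm x a a' => ih m hm
      congr 2
      by_cases hle : k < k' ∨ k = k' ∧ s' ≤ s
      · exact scaledGraft_eq_of_lt ih' h hr hs hk h' hr' hs' hk' ht hu ht' hu' hg hle
      · exact (scaledGraft_eq_of_lt ih' h' hr' hs' hk' h hr hs hk ht' hu' ht hu hg.symm
          (by omega)).symm
    · simp

end SimplexGraph

/-! ### The maps `|𝕂(n)| → Eₙ` -/

/-- Extension of a vector by zero to a sequence. -/
def extendZero {n : ℕ} (x : Fin n → ℝ) : ℕ → ℝ := fun j => if h : j < n then x ⟨j, h⟩ else 0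

section Extend

variable {r s n : ℕ}

@[simp] theorem extendZero_val (x : Fin n → ℝ) (j : Fin n) : extendZero x j = x j := by
  simp [extendZero]

theorem extendZero_of_lt (x : Fin n → ℝ) {j : ℕ} (hj : j < n) : extendZero x j = x ⟨j, hj⟩ :=
  dif_pos hj

theorem extendZero_of_le (x : Fin n → ℝ) {j : ℕ} (hj : n ≤ j) : extendZero x j = 0 :=
  dif_neg (by omega)

theorem extendZero_restrict {a : ℕ → ℝ} (ha : ∀ j, n ≤ j → a j = 0) :
    extendZero (fun i : Fin n => a i) = a := by
  funext j
  rcases lt_or_ge j n with hj | hj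
  · rw [extendZero_of_lt _ hj]
  · rw [extendZero_of_le _ hj, ha j hj]

theorem extendZero_combination (a b : ℝ) (x y : Fin n → ℝ) :
    extendZero (a • x + b • y) = a • extendZero x + b • extendZero y := by
  funext j
  by_cases hj : j < n <;> simp [extendZero, hj]

theorem extendZero_center (hn : 2 ≤ n) : extendZero (center n) = centerSeq n := by
  funext j
  rcases lt_or_ge j n with hj | hj
  · rw [extendZero_of_lt _ hj]
    simp [center, centerSeq, hj]
  · rw [extendZero_of_le _ hj, (inPolytope_centerSeq hn).eq_zero j hj]

theorem extendZero_faceMap (h : r + s = n + 1) (hs : 2 ≤ s) (k : Fin r) (t : Fin r → ℝ)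
    (u : Fin s → ℝ) :
    extendZero (faceMap h hs k t u) = graft k s (extendZero t) (extendZero u) := by
  have hk := k.2
  funext j
  rcases lt_or_ge j n with hj | hj
  · rw [extendZero_of_lt _ hj]
    simp only [faceMap, graft]
    split_ifs with h1 h2 h3
    · rw [extendZero_of_lt]
    · rw [extendZero_of_lt]
    · rw [extendZero_of_lt _ (show s - 1 < s by omega), extendZero_val]
    · rw [extendZero_of_lt]
  · rw [extendZero_of_le _ hj, graft, if_neg (by omega), if_neg (by omega), if_neg (by omega),
      extendZero_of_le _ (by omega)]

theorem simplexFaceMap_apply (h : r + s = n + 1) (hs : 2 ≤ s) (k : Fin r) (x : Fin r → ℝ)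
    (y : Fin s → ℝ) (j : Fin n) :
    simplexFaceMap h hs k x y j = scaledGraft k s (extendZero x) (extendZero y) j := by
  have hk := k.2
  simp only [simplexFaceMap, scaledGraft, extendZero_val]
  split_ifs with h1 h2
  · rw [extendZero_of_lt]
  · rw [extendZero_of_lt]
  · rw [extendZero_of_lt]

theorem psum_extendZero (x : Fin n → ℝ) {m : ℕ} (hm : m ≤ n) :
    psum (extendZero x) m = ∑ j ∈ Finset.univ.filter (fun j : Fin n => j.val < m), x j := by
  have h1 := Fin.sum_univ_eq_sum_range (fun i => if i < m then extendZero x i else 0) n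
  simp only [extendZero_val] at h1
  rw [Finset.sum_filter, h1, ← Finset.sum_filter, psum]
  congr 1
  ext i
  simp only [Finset.mem_range, Finset.mem_filter]
  omega

end Extend

/-! ### Smooth lifts along characteristic maps -/

theorem smoothTransition_clamp (t : ℝ) :
    Real.smoothTransition (clamp t) = Real.smoothTransition t := by
  rw [clamp]
  rcases le_total t 0 with h | h
  · rw [max_eq_left ((min_le_right _ _).trans h), Real.smoothTransition.zero,
      Real.smoothTransition.zero_of_nonpos h]
  · rcases le_total t 1 with h1 | h1
    · rw [min_eq_right h1, max_eq_right h]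
    · rw [min_eq_left h1, max_eq_right zero_le_one, Real.smoothTransition.one,
        Real.smoothTransition.one_of_one_le h1]

theorem clamp_mem (t : ℝ) : 0 ≤ clamp t ∧ clamp t ≤ 1 :=
  ⟨le_max_left _ _, max_le zero_le_one (min_le_left _ _)⟩

theorem contDiff_coords {l m : ℕ} (e : Fin l → Fin m) :
    ContDiff ℝ ∞ fun z : EuclideanSpace ℝ (Fin m) =>
      (WithLp.toLp 2 fun i => z (e i) : EuclideanSpace ℝ (Fin l)) := by
  rw [contDiff_euclidean]
  intro i
  fun_prop

theorem exists_contDiff_face {r s n : ℕ} (h : r + s = n + 1) (hs : 2 ≤ s)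
    (k : Fin r) {σ : CubicCell r} {τ : CubicCell s}
    (hσ : ∃ f : EuclideanSpace ℝ (Fin σ.dim) → ℕ → ℝ, (∀ j, ContDiff ℝ ∞ fun z => f z j) ∧
      ∀ z, SimplexGraph r (extendZero (σ.chart z)) (f z))
    (hτ : ∃ f : EuclideanSpace ℝ (Fin τ.dim) → ℕ → ℝ, (∀ j, ContDiff ℝ ∞ fun z => f z j) ∧
      ∀ z, SimplexGraph s (extendZero (τ.chart z)) (f z)) :
    ∃ f : EuclideanSpace ℝ (Fin (faceCell h hs k σ τ).dim) → ℕ → ℝ,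
      (∀ j, ContDiff ℝ ∞ fun z => f z j) ∧
      ∀ z, ∃ t u a b, SimplexGraph r t a ∧ SimplexGraph s u b ∧
        extendZero ((faceCell h hs k σ τ).chart z) = graft k s t u ∧
        f z = scaledGraft k s a b := by
  obtain ⟨f, hf, hfg⟩ := hσ
  obtain ⟨g, hg, hgg⟩ := hτ
  refine ⟨fun z => scaledGraft k s (f (WithLp.toLp 2 fun i => z (Fin.castAdd τ.dim i)))
    (g (WithLp.toLp 2 fun i => z (Fin.natAdd σ.dim i))), fun j => ?_, fun z =>
    ⟨_, _, _, _, hfg _, hgg _, ?_, rfl⟩⟩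
  · have hf' := fun j => (hf j).comp (contDiff_coords (Fin.castAdd (n := σ.dim) τ.dim))
    have hg' := fun j => (hg j).comp (contDiff_coords (Fin.natAdd (m := τ.dim) σ.dim))
    simp only [scaledGraft]
    split_ifs
    exacts [hf' _, (hf' _).mul (hg' _), hf' _]
  · exact (congrArg extendZero (faceCell_chart h hs k σ τ z)).trans
      (extendZero_faceMap h hs k _ _)

theorem exists_contDiff_join {n : ℕ} {κ : CubicCell n}
    {f : EuclideanSpace ℝ (Fin κ.dim) → ℕ → ℝ} (hf : ∀ j, ContDiff ℝ ∞ fun z => f z j)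
    {p : Fin n → ℝ} {a : ℕ → ℝ} {R : (ℕ → ℝ) → (ℕ → ℝ) → Prop}
    (hR : ∀ z c, 0 ≤ c → c ≤ 1 → R ((1 - c) • extendZero (κ.chart z) + c • extendZero p)
      ((1 - Real.smoothTransition c) • f z + Real.smoothTransition c • a)) :
    ∃ g : EuclideanSpace ℝ (Fin (κ.join (CubicCell.point p)).dim) → ℕ → ℝ,
      (∀ j, ContDiff ℝ ∞ fun z => g z j) ∧
      ∀ z, R (extendZero ((κ.join (CubicCell.point p)).chart z)) (g z) := by
  have hl : ContDiff ℝ ∞ fun z : EuclideanSpace ℝ (Fin (κ.dim + 1 + 0)) =>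
      Real.smoothTransition (z (Fin.castAdd 0 (Fin.natAdd κ.dim 0))) :=
    Real.smoothTransition.contDiff.comp (by fun_prop)
  refine ⟨fun z => (1 - Real.smoothTransition (z (Fin.castAdd 0 (Fin.natAdd κ.dim 0)))) •
    f (WithLp.toLp 2 fun i => z (Fin.castAdd 0 (Fin.castAdd 1 i))) +
    Real.smoothTransition (z (Fin.castAdd 0 (Fin.natAdd κ.dim 0))) • a, fun j => ?_, fun z => ?_⟩
  · have hf' := (hf j).comp
      (contDiff_coords fun i : Fin κ.dim => Fin.castAdd 0 (Fin.castAdd 1 i))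
    exact ((contDiff_const (c := (1 : ℝ)).sub hl).mul hf').add
      (hl.mul (contDiff_const (c := a j)))
  · have h := hR (WithLp.toLp 2 fun i => z (Fin.castAdd 0 (Fin.castAdd 1 i))) _
      (clamp_mem (z (Fin.castAdd 0 (Fin.natAdd κ.dim 0)))).1
      (clamp_mem (z (Fin.castAdd 0 (Fin.natAdd κ.dim 0)))).2
    rw [smoothTransition_clamp, ← extendZero_combination] at h
    exact h

/-- Each cell gets its own smooth lift by induction on its construction. No compatibility between
cells has to be checked here, since `SimplexGraph.unique` forces all lifts to agree. -/
theorem IsAssocCell.exists_contDiff {n : ℕ} {σ : CubicCell n} (hσ : IsAssocCell n σ) :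
    ∃ f : EuclideanSpace ℝ (Fin σ.dim) → ℕ → ℝ, (∀ j, ContDiff ℝ ∞ fun z => f z j) ∧
      ∀ z, SimplexGraph n (extendZero (σ.chart z)) (f z) := by
  induction hσ with
  | center n hn =>
    refine ⟨fun _ => barycenterSeq n, fun _ => contDiff_const, fun z => ?_⟩
    exact (extendZero_center hn).symm ▸ SimplexGraph.center hn
  | @face r s n h hr hs k σ τ _ _ ihσ ihτ =>
    obtain ⟨f, hf, hfg⟩ := exists_contDiff_face h hs k ihσ ihτ
    refine ⟨f, hf, fun z => ?_⟩
    obtain ⟨t, u, a, b, ht, hu, h1, h2⟩ := hfg z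
    rw [h1, h2]
    exact SimplexGraph.face h hr hs k.2 ht hu
  | @cone r s n h hr hs k σ τ _ _ ihσ ihτ =>
    obtain ⟨f, hf, hfg⟩ := exists_contDiff_face h hs k ihσ ihτ
    refine exists_contDiff_join (R := SimplexGraph n) (a := barycenterSeq n) hf
      fun z c h0 h1 => ?_
    rw [extendZero_center (by omega)]
    obtain ⟨t, u, a, b, ht, hu, h2, h3⟩ := hfg z
    rw [h2, h3]
    exact SimplexGraph.cone h hr hs k.2 ht hu h0 h1

theorem Associahedron.exists_simplexGraph {n : ℕ} (ρ : Associahedron n) :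
    ∃ a, SimplexGraph n (extendZero ρ.val) a := by
  obtain ⟨σ, hσ, z, hz⟩ := ρ.mem
  obtain ⟨f, -, hf⟩ := hσ.exists_contDiff
  exact ⟨_, hz ▸ hf z⟩

/-- The multiplicative family of maps `|𝕂(n)| → Eₙ`. -/
def Associahedron.toSimplex {n : ℕ} (ρ : Associahedron n) : OpenSimplex n where
  val i := ρ.exists_simplexGraph.choose i
  pos i := ρ.exists_simplexGraph.choose_spec.pos_sum_support.1 i i.2
  sum_eq := by
    rw [Fin.sum_univ_eq_sum_range]
    exact ρ.exists_simplexGraph.choose_spec.pos_sum_support.2.1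

theorem Associahedron.extendZero_toSimplex {n : ℕ} (ρ : Associahedron n) {a : ℕ → ℝ}
    (ha : SimplexGraph n (extendZero ρ.val) a) : extendZero ρ.toSimplex.val = a :=
  (extendZero_restrict ρ.exists_simplexGraph.choose_spec.pos_sum_support.2.2).trans
    (ρ.exists_simplexGraph.choose_spec.unique ha)

theorem Associahedron.toSimplex_val {n : ℕ} (ρ : Associahedron n) {a : ℕ → ℝ}
    (ha : SimplexGraph n (extendZero ρ.val) a) (i : Fin n) : ρ.toSimplex.val i = a i := by
  rw [← ρ.extendZero_toSimplex ha, extendZero_val]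

theorem Associahedron.simplexGraph_toSimplex {n : ℕ} (ρ : Associahedron n) :
    SimplexGraph n (extendZero ρ.val) (extendZero ρ.toSimplex.val) := by
  obtain ⟨a, ha⟩ := ρ.exists_simplexGraph
  rwa [ρ.extendZero_toSimplex ha]

theorem Associahedron.toSimplex_center {n : ℕ} (hn : 2 ≤ n) :
    (Associahedron.center n hn).toSimplex = OpenSimplex.barycenter n hn := by
  have h : SimplexGraph n (extendZero (Associahedron.center n hn).val) (barycenterSeq n) :=
    (extendZero_center hn).symm ▸ SimplexGraph.center hn
  have h1 : (Associahedron.center n hn).toSimplex.val = (OpenSimplex.barycenter n hn).val := by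
    funext i
    rw [toSimplex_val _ h, barycenterSeq, if_pos i.2]
    rfl
  cases h2 : (Associahedron.center n hn).toSimplex
  rw [h2] at h1
  cases h1
  rfl

theorem Associahedron.toSimplex_face {r s n : ℕ} (h : r + s = n + 1) (hr : 2 ≤ r) (hs : 2 ≤ s)
    (k : Fin r) (ρ : Associahedron r) (σ : Associahedron s) :
    (Associahedron.face h hr hs k ρ σ).toSimplex.val =
      simplexFaceMap h hs k ρ.toSimplex.val σ.toSimplex.val := by
  have h1 := SimplexGraph.face h hr hs k.2 ρ.simplexGraph_toSimplex σ.simplexGraph_toSimplex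
  rw [← extendZero_faceMap h hs] at h1
  funext j
  rw [simplexFaceMap_apply]
  exact toSimplex_val (Associahedron.face h hr hs k ρ σ) h1 j

/-- The diffeology induced along `f` contains the generators, hence every plot of the generated
diffeology. -/
theorem dSmooth_generateFrom {X Y : Type*} [DiffeologicalSpace Y]
    {g : Set ((n : ℕ) × (EuclideanSpace ℝ (Fin n) → X))} {f : X → Y}
    (h : ∀ (n : ℕ) (p : EuclideanSpace ℝ (Fin n) → X), ⟨n, p⟩ ∈ g → IsPlot (f ∘ p)) :
    @DSmooth X Y (DiffeologicalSpace.generateFrom g) _ f :=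
  fun _ _ hp => hp (inducedDiffeology f) fun q hq => h q.1 q.2 hq

theorem Associahedron.dSmooth_toSimplex (n : ℕ) :
    DSmooth (Associahedron.toSimplex : Associahedron n → OpenSimplex n) := by
  refine dSmooth_generateFrom ?_
  rintro _ _ ⟨σ, hσ, ⟨⟩⟩
  obtain ⟨f, hf, hfg⟩ := hσ.exists_contDiff
  intro i
  refine ContDiff.isPlot ?_
  have h1 : (fun z => (Associahedron.chart σ hσ z).toSimplex.val i) = fun z => f z i :=
    funext fun z => toSimplex_val _ (hfg z) i
  exact h1 ▸ hf i

/-! ### Concatenation of paths -/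

/-- The `i`-th of the subintervals of `ℝ` with lengths `r`, the first and last being unbounded. -/
def InPiece (r : ℕ → ℝ) (n i : ℕ) (t : ℝ) : Prop :=
  (i = 0 ∨ psum r i ≤ t) ∧ (i + 1 = n ∨ t ≤ psum r (i + 1))

section Piece

variable {r : ℕ → ℝ} {n : ℕ}

theorem exists_inPiece (r : ℕ → ℝ) (hn : 0 < n) (t : ℝ) : ∃ i < n, InPiece r n i t := by
  classical
  -- If no index qualifies, the default value `0` is the right one: the first piece is unbounded
  -- below.
  set m := Nat.findGreatest (fun i => psum r i ≤ t) (n - 1) with hm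
  have hmn : m ≤ n - 1 := Nat.findGreatest_le _
  refine ⟨m, by omega, ?_, ?_⟩
  · rcases Nat.eq_zero_or_pos m with h | h
    · exact Or.inl h
    · exact Or.inr (Nat.findGreatest_of_ne_zero hm.symm h.ne')
  · by_cases h : m + 1 = n
    · exact Or.inl h
    · have h1 : ¬ psum r (m + 1) ≤ t :=
        Nat.findGreatest_is_greatest (n := n - 1) (hm ▸ Nat.lt_succ_self m) (by omega)
      exact Or.inr (not_le.1 h1).le

theorem OpenSimplex.extendZero_pos (r : OpenSimplex n) {i : ℕ} (hi : i < n) :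
    0 < extendZero r.val i := by
  rw [extendZero_of_lt _ hi]; exact r.pos _

theorem OpenSimplex.extendZero_nonneg (r : OpenSimplex n) (i : ℕ) : 0 ≤ extendZero r.val i := by
  rcases lt_or_ge i n with h | h
  · exact (r.extendZero_pos h).le
  · rw [extendZero_of_le _ h]

theorem OpenSimplex.psum_self (r : OpenSimplex n) : psum (extendZero r.val) n = 1 := by
  rw [psum_extendZero _ le_rfl, ← r.sum_eq]
  simp

theorem OpenSimplex.size_pos (r : OpenSimplex n) : 0 < n := by
  by_contra h
  obtain rfl : n = 0 := by omega
  simpa using r.sum_eq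

theorem OpenSimplex.psum_le_one (r : OpenSimplex n) {i : ℕ} (hi : i ≤ n) :
    psum (extendZero r.val) i ≤ 1 :=
  r.psum_self ▸ psum_mono r.extendZero_nonneg hi

theorem OpenSimplex.psum_nonneg (r : OpenSimplex n) (i : ℕ) : 0 ≤ psum (extendZero r.val) i :=
  psum_zero (extendZero r.val) ▸ psum_mono r.extendZero_nonneg (Nat.zero_le i)

end Piece

section Paths

variable {X : Type*} [DiffeologicalSpace X] {n : ℕ}

theorem PathSpace.ext {u v : PathSpace X} (h : ∀ t, u t = v t) : u = v := by
  obtain ⟨⟨u, hu⟩, hu'⟩ := u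
  obtain ⟨⟨v, hv⟩, hv'⟩ := v
  obtain rfl : u = v := funext h
  rfl

theorem PathSpace.apply_of_nonpos (u : PathSpace X) {t : ℝ} (ht : t ≤ 0) : u t = u 0 := by
  rw [← u.clamp_eq t, clamp, max_eq_left ((min_le_right _ _).trans ht)]

theorem PathSpace.apply_of_one_le (u : PathSpace X) {t : ℝ} (ht : 1 ≤ t) : u t = u 1 := by
  rw [← u.clamp_eq t, clamp, min_eq_left ht, max_eq_right zero_le_one]

theorem clamp_eq_of_endpoints {Y : Type*} {f : ℝ → Y} (h0 : ∀ t ≤ 0, f t = f 0)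
    (h1 : ∀ t, 1 ≤ t → f t = f 1) (t : ℝ) : f (clamp t) = f t := by
  rcases le_total t 0 with h | h
  · rw [clamp, max_eq_left ((min_le_right _ _).trans h), h0 t h]
  · rcases le_total t 1 with h2 | h2
    · rw [clamp, min_eq_right h2, max_eq_right h]
    · rw [clamp, min_eq_left h2, max_eq_right zero_le_one, h1 t h2]

theorem IsPlot.eval {m : ℕ} {p : EuclideanSpace ℝ (Fin m) → PathSpace X} (hp : IsPlot p)
    {τ : EuclideanSpace ℝ (Fin m) → ℝ} (hτ : ContDiff ℝ ∞ τ) : IsPlot fun z => p z (τ z) :=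
  hp _ (fun z => (z, τ z)) ⟨isPlot_id, hτ.isPlot⟩

theorem Composable.target_eq_source (u : Composable (pathPrecategory X) n) {i : ℕ}
    (hi : i + 1 < n) : u.arrow ⟨i, by omega⟩ 1 = u.arrow ⟨i + 1, hi⟩ 0 :=
  u.composable ⟨i, by omega⟩ ⟨i + 1, hi⟩ rfl

theorem isConcatenation_iff {r : OpenSimplex n} {u : Composable (pathPrecategory X) n}
    {v : PathSpace X} :
    IsConcatenation r u v ↔ ∀ (i : ℕ) (hi : i < n) (t : ℝ), InPiece (extendZero r.val) n i t →
      v t = u.arrow ⟨i, hi⟩ ((t - psum (extendZero r.val) i) / extendZero r.val i) := by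
  have h1 : ∀ i : Fin n, ∑ j ∈ Finset.univ.filter (fun j => j < i), r.val j =
      psum (extendZero r.val) i := fun i => by
    rw [psum_extendZero _ i.2.le]; rfl
  have h2 : ∀ i : Fin n, ∑ j ∈ Finset.univ.filter (fun j => j ≤ i), r.val j =
      psum (extendZero r.val) (i + 1) := fun i => by
    rw [psum_extendZero _ i.2]
    exact Finset.sum_congr (Finset.filter_congr fun j _ => Nat.lt_succ_iff.symm) fun _ _ => rfl
  simp only [IsConcatenation, h1, h2, InPiece]
  constructor
  · intro h i hi t ht
    simpa [extendZero_of_lt _ hi] using h ⟨i, hi⟩ t ht.1 ht.2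
  · intro h i t ha hb
    simpa using h i i.2 t ⟨ha, hb⟩

/-- The values of the concatenation of paths. -/
def concat (r : OpenSimplex n) (u : Composable (pathPrecategory X) n) (t : ℝ) : X :=
  u.arrow ⟨(exists_inPiece (extendZero r.val) r.size_pos t).choose,
    (exists_inPiece (extendZero r.val) r.size_pos t).choose_spec.1⟩
    ((t - psum (extendZero r.val) (exists_inPiece (extendZero r.val) r.size_pos t).choose) /
      extendZero r.val (exists_inPiece (extendZero r.val) r.size_pos t).choose)

theorem piece_agree (r : OpenSimplex n) (u : Composable (pathPrecategory X) n) {i j : ℕ} {t : ℝ}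
    (hij : i < j) (hj : j < n) (hit : InPiece (extendZero r.val) n i t)
    (hjt : InPiece (extendZero r.val) n j t) :
    u.arrow ⟨i, hij.trans hj⟩ ((t - psum (extendZero r.val) i) / extendZero r.val i) =
      u.arrow ⟨j, hj⟩ ((t - psum (extendZero r.val) j) / extendZero r.val j) := by
  have h1 : t ≤ psum (extendZero r.val) (i + 1) := hit.2.resolve_left (by omega)
  have h2 : psum (extendZero r.val) j ≤ t := hjt.1.resolve_left (by omega)
  -- Positive lengths allow only neighbouring pieces to meet, and only at their common end point,
  -- where composability applies.
  obtain rfl : j = i + 1 := by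
    by_contra h3
    have h4 := psum_mono r.extendZero_nonneg (show i + 1 + 1 ≤ j by omega)
    rw [psum_succ] at h4
    linarith [r.extendZero_pos (show i + 1 < n by omega)]
  have h3 : t = psum (extendZero r.val) (i + 1) := le_antisymm h1 h2
  have h4 := (r.extendZero_pos (show i < n by omega)).ne'
  rw [h3, sub_self, zero_div, psum_succ, add_sub_cancel_left, div_self h4]
  exact u.target_eq_source hj

theorem concat_eq (r : OpenSimplex n) (u : Composable (pathPrecategory X) n) {i : ℕ} (hi : i < n)
    {t : ℝ} (hit : InPiece (extendZero r.val) n i t) :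
    concat r u t =
      u.arrow ⟨i, hi⟩ ((t - psum (extendZero r.val) i) / extendZero r.val i) := by
  obtain ⟨h1, h2⟩ := (exists_inPiece (extendZero r.val) r.size_pos t).choose_spec
  rcases lt_trichotomy (exists_inPiece (extendZero r.val) r.size_pos t).choose i with h | h | h
  · exact piece_agree r u h hi h2 hit
  · simp only [concat, h]
  · exact (piece_agree r u h h1 hit h2).symm

theorem concat_of_nonpos (r : OpenSimplex n) (u : Composable (pathPrecategory X) n) {t : ℝ}
    (ht : t ≤ 0) : concat r u t = u.arrow ⟨0, r.size_pos⟩ 0 := by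
  rw [concat_eq r u r.size_pos ⟨Or.inl rfl, Or.inr (ht.trans (r.psum_nonneg _))⟩]
  refine PathSpace.apply_of_nonpos _ (div_nonpos_of_nonpos_of_nonneg ?_ (r.extendZero_nonneg 0))
  simpa using ht

theorem concat_of_one_le (r : OpenSimplex n) (u : Composable (pathPrecategory X) n) {t : ℝ}
    (ht : 1 ≤ t) : concat r u t = u.arrow ⟨n - 1, Nat.sub_one_lt_of_lt r.size_pos⟩ 1 := by
  have hn := r.size_pos
  have hlt : n - 1 < n := Nat.sub_one_lt_of_lt hn
  rw [concat_eq r u hlt ⟨Or.inr ((r.psum_le_one hlt.le).trans ht), Or.inl (by omega)⟩]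
  refine PathSpace.apply_of_one_le _ ?_
  rw [le_div_iff₀ (r.extendZero_pos hlt)]
  have h1 := psum_succ (extendZero r.val) (n - 1)
  rw [show n - 1 + 1 = n by omega, r.psum_self] at h1
  linarith

/-- If `t` lies in piece `m`, each earlier summand is the full increment of `φ` along its path and
each later one vanishes. By composability the earlier ones telescope to the value at the start of
the `m`-th path. -/
theorem comp_concat (r : OpenSimplex n) (u : Composable (pathPrecategory X) n) (t : ℝ)
    (φ : X → ℝ) :
    φ (concat r u t) = φ (u.arrow ⟨0, r.size_pos⟩ 0) + ∑ i : Fin n,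
      (φ (u.arrow i ((t - psum (extendZero r.val) i) / r.val i)) - φ (u.arrow i 0)) := by
  obtain ⟨m, hm, hmt⟩ := exists_inPiece (extendZero r.val) r.size_pos t
  rw [concat_eq r u hm hmt]
  set A : Fin n → ℝ := fun i =>
    φ (u.arrow i ((t - psum (extendZero r.val) i) / r.val i)) - φ (u.arrow i 0) with hA
  have hlow : ∀ i, (hi : i < n) → (him : i < m) → A ⟨i, hi⟩ =
      φ (u.arrow ⟨i + 1, by omega⟩ 0) - φ (u.arrow ⟨i, hi⟩ 0) := fun i hi him => by
    have h1 : psum (extendZero r.val) m ≤ t := hmt.1.resolve_left (by omega)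
    have h2 := psum_mono r.extendZero_nonneg (show i + 1 ≤ m by omega)
    rw [psum_succ, extendZero_of_lt _ hi] at h2
    simp only [hA]
    rw [PathSpace.apply_of_one_le _ ((one_le_div₀ (r.pos _)).2 (by linarith)),
      u.target_eq_source (by omega)]
  have hhigh : ∀ i, (hi : i < n) → m < i → A ⟨i, hi⟩ = 0 := fun i hi him => by
    have h1 : t ≤ psum (extendZero r.val) (m + 1) := hmt.2.resolve_left (by omega)
    have h2 := psum_mono r.extendZero_nonneg (show m + 1 ≤ i by omega)
    simp only [hA]
    rw [PathSpace.apply_of_nonpos _ (div_nonpos_of_nonpos_of_nonneg (by simp; linarith)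
      (r.pos _).le), sub_self]
  have hbelow : ∀ l, (hl : l ≤ m) → φ (u.arrow ⟨0, r.size_pos⟩ 0) + psum (extendZero A) l =
      φ (u.arrow ⟨l, by omega⟩ 0) := fun l hl => by
    induction l with
    | zero => simp
    | succ l ih =>
      rw [psum_succ, extendZero_of_lt _ (by omega), hlow l (by omega) (by omega),
        ← add_assoc, ih (by omega)]
      ring
  have habove : ∀ l, psum (extendZero A) (m + 1 + l) = psum (extendZero A) (m + 1) := fun l => by
    induction l with
    | zero => rfl
    | succ l ih =>
      rw [← add_assoc, psum_succ, ih]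
      rcases lt_or_ge (m + 1 + l) n with h | h
      · rw [extendZero_of_lt _ h, hhigh _ h (by omega), add_zero]
      · rw [extendZero_of_le _ h, add_zero]
  have htotal : ∑ i, A i = psum (extendZero A) n := by
    rw [psum_extendZero _ le_rfl]; simp
  have hn := habove (n - (m + 1))
  rw [Nat.add_sub_cancel' hm] at hn
  rw [htotal, hn, psum_succ, ← add_assoc,
    hbelow m le_rfl, extendZero_of_lt _ hm, extendZero_of_lt _ hm]
  simp only [hA]
  ring

theorem isPlot_concat (hX : IsReflexive X) {m : ℕ} {ρ : EuclideanSpace ℝ (Fin m) → OpenSimplex n}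
    {u : EuclideanSpace ℝ (Fin m) → Composable (pathPrecategory X) n}
    {τ : EuclideanSpace ℝ (Fin m) → ℝ} (hρ : IsPlot ρ) (hu : IsPlot u) (hτ : ContDiff ℝ ∞ τ) :
    IsPlot fun z => concat (ρ z) (u z) (τ z) := by
  refine hX _ _ fun φ hφ => ?_
  have hlen : ∀ i, ContDiff ℝ ∞ fun z => (ρ z).val i := fun i => (hρ i).contDiff
  have hpsum : ∀ i : Fin n, ContDiff ℝ ∞ fun z => psum (extendZero (ρ z).val) i := fun i => by
    simp only [psum_extendZero _ i.2.le]
    exact ContDiff.sum fun j _ => hlen j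
  have heval : ∀ (i : Fin n) {σ : EuclideanSpace ℝ (Fin m) → ℝ}, ContDiff ℝ ∞ σ →
      ContDiff ℝ ∞ fun z => φ ((u z).arrow i (σ z)) := fun i σ hσ =>
    (hφ _ _ (IsPlot.eval (p := fun z => (u z).arrow i) (hu i) hσ)).contDiff
  have hformula : (φ ∘ fun z => concat (ρ z) (u z) (τ z)) = _ :=
    funext fun z => comp_concat (ρ z) (u z) (τ z) φ
  rw [hformula]
  refine (heval ⟨0, (ρ 0).size_pos⟩ contDiff_const).add (ContDiff.sum fun i _ => ?_)
  exact (heval i ((hτ.sub (hpsum i)).div (hlen i) fun z => ((ρ z).pos i).ne')).sub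
    (heval i contDiff_const)

theorem dSmooth_concat (hX : IsReflexive X) (r : OpenSimplex n)
    (u : Composable (pathPrecategory X) n) : DSmooth (concat r u) := fun _ _ hp =>
  isPlot_concat hX (ρ := fun _ => r) (u := fun _ => u) isPlot_const isPlot_const hp.contDiff

/-- The concatenation of a string of paths in a reflexive space. -/
def concatPath (hX : IsReflexive X) (r : OpenSimplex n)
    (u : Composable (pathPrecategory X) n) : PathSpace X where
  toSmoothMap := ⟨concat r u, dSmooth_concat hX r u⟩
  clamp_eq := clamp_eq_of_endpoints (f := concat r u)
    (fun t ht => by rw [concat_of_nonpos r u ht, concat_of_nonpos r u le_rfl])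
    (fun t ht => by rw [concat_of_one_le r u ht, concat_of_one_le r u le_rfl])

/-- Plots of the path space are tested on adjoints, so this is `isPlot_concat` with time as one more
parameter. -/
theorem dSmooth_concatPath (hX : IsReflexive X) (n : ℕ) :
    DSmooth fun z : OpenSimplex n × Composable (pathPrecategory X) n =>
      concatPath hX z.1 z.2 :=
  fun _ _ hq _ _ hw => isPlot_concat hX
    (isPlot_reparam hq.1 hw.1.contDiff) (isPlot_reparam hq.2 hw.1.contDiff) hw.2.contDiff

theorem isConcatenation_concatPath (hX : IsReflexive X) (r : OpenSimplex n)
    (u : Composable (pathPrecategory X) n) : IsConcatenation r u (concatPath hX r u) :=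
  isConcatenation_iff.2 fun _ hi _ ht => concat_eq r u hi ht

theorem IsConcatenation.unique {r : OpenSimplex n} {u : Composable (pathPrecategory X) n}
    {v w : PathSpace X} (hv : IsConcatenation r u v) (hw : IsConcatenation r u w) : v = w := by
  refine PathSpace.ext fun t => ?_
  obtain ⟨i, hi, ht⟩ := exists_inPiece (extendZero r.val) r.size_pos t
  rw [isConcatenation_iff.1 hv i hi t ht, isConcatenation_iff.1 hw i hi t ht]

/-! ### Nested concatenations -/

section Contract

variable {G Y : Type*} [DiffeologicalSpace G] [DiffeologicalSpace Y]
  {C : InternalPrecategory G Y} {r s : ℕ} {h : r + s = n + 1} {hs : 2 ≤ s} {k : Fin r}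
  {g : Composable C n} {m : G} {hsrc : C.source m = C.source (g.arrow ⟨k.val, by omega⟩)}
  {htgt : C.target m = C.target (g.arrow ⟨k.val + (s - 1), by omega⟩)}

theorem Composable.contract_arrow_of_lt {i : ℕ} (hi : i < r) (hik : i < k.val) :
    (g.contract h hs k m hsrc htgt).arrow ⟨i, hi⟩ = g.arrow ⟨i, by omega⟩ :=
  if_pos hik

theorem Composable.contract_arrow_self :
    (g.contract h hs k m hsrc htgt).arrow ⟨k, k.2⟩ = m :=
  (if_neg (lt_irrefl _)).trans (if_pos rfl)

theorem Composable.contract_arrow_of_gt {i : ℕ} (hi : i < r) (hik : k.val < i) :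
    (g.contract h hs k m hsrc htgt).arrow ⟨i, hi⟩ = g.arrow ⟨i + (s - 1), by omega⟩ :=
  (if_neg hik.not_gt).trans (if_neg hik.ne')

end Contract

theorem isConcatenation_contract {r s : ℕ} (h : r + s = n + 1) (hs : 2 ≤ s) (k : Fin r)
    {x : OpenSimplex r} {y : OpenSimplex s} {z : OpenSimplex n}
    (hz : z.val = simplexFaceMap h hs k x.val y.val) {u : Composable (pathPrecategory X) n}
    {v w : PathSpace X} (hw : IsConcatenation y (u.block h k) w)
    (hsrc : (pathPrecategory X).source w = (pathPrecategory X).source (u.arrow ⟨k.val, by omega⟩))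
    (htgt : (pathPrecategory X).target w =
      (pathPrecategory X).target (u.arrow ⟨k.val + (s - 1), by omega⟩))
    (hv : IsConcatenation x (u.contract h hs k w hsrc htgt) v) : IsConcatenation z u v := by
  have hk := k.2
  rw [isConcatenation_iff] at hv hw ⊢
  have hze : extendZero z.val = scaledGraft k s (extendZero x.val) (extendZero y.val) := by
    have h1 : z.val = fun i : Fin n => scaledGraft k s (extendZero x.val) (extendZero y.val) i :=
      hz.trans (funext fun i => simplexFaceMap_apply h hs k _ _ i)
    rw [h1, extendZero_restrict]
    intro j hj
    rw [scaledGraft, if_neg (by omega), if_neg (by omega), extendZero_of_le _ (by omega)]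
  rw [hze]
  intro i hi t ht
  have hxk := x.extendZero_pos hk
  rcases lt_or_ge i k with h1 | h1
  · rw [hv i (by omega) t ⟨?_, Or.inr ?_⟩, psum_scaledGraft_left h1.le,
      Composable.contract_arrow_of_lt _ h1, scaledGraft, if_pos h1]
    · simpa only [psum_scaledGraft_left h1.le] using ht.1
    · have h2 := ht.2.resolve_left (by omega)
      rwa [psum_scaledGraft_left h1] at h2
  rcases lt_or_ge i (k + s) with h2 | h2
  · obtain ⟨j, rfl⟩ := Nat.exists_eq_add_of_le h1
    have hj : j < s := by omega
    have hlow := psum_scaledGraft_mid (k := k) (t := extendZero x.val) (u := extendZero y.val)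
      hj.le
    have hup := psum_scaledGraft_mid (k := k) (t := extendZero x.val) (u := extendZero y.val) hj
    have hyj := y.extendZero_pos hj
    have hval : scaledGraft k s (extendZero x.val) (extendZero y.val) (k + j) =
        extendZero x.val k * extendZero y.val j := by
      rw [scaledGraft, if_neg (by omega), if_pos h2, Nat.add_sub_cancel_left]
    -- A piece inside the block lies in the outer piece `k`, and after rescaling in the inner piece
    -- `j`. Unbounded ends are inherited: the first piece of the composite is first in both, and
    -- likewise the last.
    have hout : InPiece (extendZero x.val) r k t := by
      constructor
      · rcases ht.1 with h3 | h3
        · exact Or.inl (by omega)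
        · rw [hlow] at h3
          exact Or.inr (by nlinarith [mul_nonneg hxk.le (y.psum_nonneg j)])
      · rcases ht.2 with h3 | h3
        · exact Or.inl (by omega)
        · rw [add_assoc, hup] at h3
          rw [psum_succ]
          exact Or.inr (by nlinarith [y.psum_le_one hj])
    have hin : InPiece (extendZero y.val) s j
        ((t - psum (extendZero x.val) k) / extendZero x.val k) := by
      constructor
      · rcases ht.1 with h3 | h3
        · exact Or.inl (by omega)
        · rw [hlow] at h3
          exact Or.inr ((le_div_iff₀ hxk).2 (by linarith))
      · rcases ht.2 with h3 | h3
        · exact Or.inl (by omega)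
        · rw [add_assoc, hup] at h3
          exact Or.inr ((div_le_iff₀ hxk).2 (by linarith))
    rw [hv k hk t hout, hlow, hval]
    rw [Composable.contract_arrow_self, hw j hj _ hin]
    simp only [Composable.block]
    congr 1
    field_simp
    ring
  · obtain ⟨j, rfl⟩ := Nat.exists_eq_add_of_le h2
    have hps := psum_scaledGraft_right (k := k) (t := extendZero x.val) (by omega) y.psum_self
    have hval : scaledGraft k s (extendZero x.val) (extendZero y.val) (k + s + j) =
        extendZero x.val (k + 1 + j) := by
      rw [scaledGraft, if_neg (by omega), if_neg (by omega)]
      congr 1; omega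
    rw [hv (k + 1 + j) (by omega) t ⟨Or.inr ?_, ?_⟩, hps, hval,
      Composable.contract_arrow_of_gt _ (by omega)]
    · congr 4
      omega
    · have h3 := ht.1.resolve_left (by omega)
      rwa [hps] at h3
    · refine ht.2.imp (by omega) fun h3 => ?_
      rwa [add_assoc, hps, ← add_assoc] at h3

/-! ### Homotopies for the units -/

/-- The coordinate of `𝕀` is not used directly as a homotopy parameter: composed with the projection
it is the non-smooth `clamp`, whereas its smooth transition pulls back to a smooth function on `ℝ`.
-/
theorem dSmooth_smoothTransition_interval :
    DSmooth fun s : Interval => Real.smoothTransition s.val := by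
  refine dSmooth_generateFrom ?_
  rintro _ _ ⟨m, p, hp, ⟨⟩⟩
  refine ContDiff.isPlot ?_
  have h : ((fun s : Interval => Real.smoothTransition s.val) ∘ Interval.proj ∘ p) =
      fun z => Real.smoothTransition (p z) := funext fun z => smoothTransition_clamp (p z)
  rw [h]
  exact Real.smoothTransition.contDiff.comp hp.contDiff

/-- The path `t ↦ u((2 - c) t - e (1 - c))`, which interpolates between `t ↦ u(2 t - e)` for
`c = 0` and `u` for `c = 1`. -/
def PathSpace.squeeze {e c : ℝ} (he : 0 ≤ e ∧ e ≤ 1) (hc : 0 ≤ c ∧ c ≤ 1) (u : PathSpace X) :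
    PathSpace X where
  toSmoothMap := ⟨fun t => u ((2 - c) * t - e * (1 - c)), fun _ _ hp =>
    IsPlot.eval (p := fun _ => u) isPlot_const
      ((contDiff_const.mul hp.contDiff).sub contDiff_const)⟩
  clamp_eq := by
    -- The affine map sends `0` to `-e (1 - c) ≤ 0` and `1` to `1 + (1 - e)(1 - c) ≥ 1`, so the end
    -- points of `u` are kept.
    have h1 : 0 ≤ e * (1 - c) := mul_nonneg he.1 (by linarith)
    have h2 : 0 ≤ (1 - e) * (1 - c) := mul_nonneg (by linarith) (by linarith)
    refine clamp_eq_of_endpoints (f := fun t => u ((2 - c) * t - e * (1 - c)))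
      (fun t ht => ?_) fun t ht => ?_
    · exact (u.apply_of_nonpos (by nlinarith)).trans (u.apply_of_nonpos (by nlinarith)).symm
    · exact (u.apply_of_one_le (by nlinarith)).trans (u.apply_of_one_le (by nlinarith)).symm

theorem smoothlyHomotopic_squeeze {e : ℝ} (he : 0 ≤ e ∧ e ≤ 1) :
    SmoothlyHomotopic (pathPrecategory X)
      (PathSpace.squeeze he ⟨le_rfl, zero_le_one⟩) id := by
  refine ⟨fun z => PathSpace.squeeze he (c := Real.smoothTransition z.1.val)
    ⟨Real.smoothTransition.nonneg _, Real.smoothTransition.le_one _⟩ z.2, ?_, fun u => ?_,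
    fun u => ?_, fun s u => ?_⟩
  · intro m q hq l w hw
    have h1 : ContDiff ℝ ∞ fun y => Real.smoothTransition (q (w y).1).1.val :=
      (dSmooth_smoothTransition_interval _ _ (isPlot_reparam hq.1 hw.1.contDiff)).contDiff
    exact IsPlot.eval (p := fun y => (q (w y).1).2) (isPlot_reparam hq.2 hw.1.contDiff)
      (((contDiff_const.sub h1).mul hw.2.contDiff).sub
        (contDiff_const.mul (contDiff_const.sub h1)))
  · refine PathSpace.ext fun t => ?_
    simp [PathSpace.squeeze, Interval.proj, clamp]
  · refine PathSpace.ext fun t => ?_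
    simp only [PathSpace.squeeze, Interval.proj, clamp, id]
    congr 1
    simp
    ring
  · have h0 := Real.smoothTransition.nonneg s.val
    have h1 := Real.smoothTransition.le_one s.val
    have h2 : 0 ≤ e * (1 - Real.smoothTransition s.val) := mul_nonneg he.1 (by linarith)
    have h3 : 0 ≤ (1 - e) * (1 - Real.smoothTransition s.val) :=
      mul_nonneg (by linarith) (by linarith)
    exact ⟨u.apply_of_nonpos (by nlinarith), u.apply_of_one_le (by nlinarith)⟩

theorem isConcatenation_pair {f g v : PathSpace X} {h} (h0 : ∀ t, t ≤ 1 / 2 → v t = f (2 * t))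
    (h1 : ∀ t, 1 / 2 ≤ t → v t = g (2 * t - 1)) :
    IsConcatenation (OpenSimplex.barycenter 2 le_rfl)
      (Composable.pair (pathPrecategory X) f g h) v := by
  rw [isConcatenation_iff]
  have he : ∀ i < 2, extendZero (OpenSimplex.barycenter 2 le_rfl).val i = 1 / 2 := fun i hi => by
    rw [extendZero_of_lt _ hi]; simp [OpenSimplex.barycenter]
  intro i hi t ht
  rw [InPiece] at ht
  interval_cases i
  · simp only [psum_succ, psum_zero, he 0 (by omega)] at ht ⊢
    rw [h0 t (by simpa using ht)]
    simp only [Composable.pair]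
    change f _ = f _
    congr 1
    ring
  · simp only [psum_succ, psum_zero, he 0 (by omega), he 1 (by omega)] at ht ⊢
    rw [h1 t (by simpa using ht)]
    simp only [Composable.pair]
    change g _ = g _
    congr 1
    ring

/-! ### Paths as maps on the interval -/

/-- A product with the quotient `𝕀` is handled by currying: a map out of `𝕀` into a space of smooth
maps may be tested after composition with the projection from `ℝ`, where `u ∘ clamp = u` removes the
`clamp`. -/
theorem dSmooth_eval_interval {n : ℕ} {p : EuclideanSpace ℝ (Fin n) → PathSpace X}
    (hp : IsPlot p) :
    DSmooth fun z : EuclideanSpace ℝ (Fin n) × Interval => p z.1 z.2.val := by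
  have hev : DSmooth fun s : Interval =>
      (⟨fun z => p z s.val, fun _ _ hq => IsPlot.eval (isPlot_reparam hp hq.contDiff)
        contDiff_const⟩ : SmoothMap (EuclideanSpace ℝ (Fin n)) X) := by
    refine dSmooth_generateFrom ?_
    rintro _ _ ⟨m, q, hq, ⟨⟩⟩
    intro l w hw
    have h : (fun y => p (w y).2 (Interval.proj (q (w y).1)).val) =
        fun y => p (w y).2 (q (w y).1) := funext fun y => (p (w y).2).clamp_eq _
    have h1 : IsPlot fun y => p (w y).2 (q (w y).1) :=
      IsPlot.eval (p := fun y => p (w y).2) (isPlot_reparam hp hw.2.contDiff)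
        (hq.contDiff.comp hw.1.contDiff)
    rw [← h] at h1
    exact h1
  exact fun m q hq => hev m _ hq.2 m (fun y => (y, (q y).1)) ⟨isPlot_id, hq.1⟩

theorem isDiffeomorphism_ofInterval :
    IsDiffeomorphism (PathSpace.ofInterval : SmoothMap Interval X → PathSpace X) := by
  refine ⟨fun n p hp m q hq => hp m (fun y => ((q y).1, Interval.proj (q y).2))
    ⟨hq.1, Interval.dSmooth_proj _ _ hq.2⟩, fun u => ⟨fun s => u s.val, fun m q hq =>
      dSmooth_eval_interval (n := m) (p := fun _ => u) isPlot_const m (fun y => (y, q y))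
        ⟨isPlot_id, hq⟩⟩, fun n p hp => dSmooth_eval_interval hp, fun u => ?_, fun u => ?_⟩
  · obtain ⟨u, hu⟩ := u
    have h : (fun s : Interval => u (Interval.proj s.val)) = u := funext fun s => by
      congr 1
      obtain ⟨s, h0, h1⟩ := s
      simp [Interval.proj, clamp, h0, h1]
    simp only [PathSpace.ofInterval, h]
  · exact PathSpace.ext fun t => u.clamp_eq t

/-! ### Assembly of the `A_∞`-form -/

theorem isHUnitalAInftyForm_concatPath (hX : IsReflexive X) :
    IsHUnitalAInftyForm (pathPrecategory X)
      fun n (z : Associahedron n × Composable (pathPrecategory X) n) =>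
        concatPath hX z.1.toSimplex z.2 where
  smooth n _ := fun m q hq => dSmooth_concatPath hX n m (fun y => ((q y).1.toSimplex, (q y).2))
    ⟨Associahedron.dSmooth_toSimplex n _ _ hq.1, hq.2⟩
  source_eq _ _ ρ g := concat_of_nonpos ρ.toSimplex g le_rfl
  target_eq _ _ ρ g := concat_of_one_le ρ.toSimplex g le_rfl
  assoc r s n h hr hs k ρ σ g :=
    (isConcatenation_concatPath hX _ _).unique
      (isConcatenation_contract h hs k (Associahedron.toSimplex_face h hr hs k ρ σ)
        (isConcatenation_concatPath hX _ _) (concat_of_nonpos σ.toSimplex (g.block h k) le_rfl)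
        (concat_of_one_le σ.toSimplex (g.block h k) le_rfl) (isConcatenation_concatPath hX _ _))
  left_unit := by
    -- With a constant path in front, the composite is `t ↦ u (2 t - 1)`, hence `e = 1`; a constant
    -- path behind gives `u (2 t)`, hence `e = 0`.
    convert smoothlyHomotopic_squeeze (X := X) (e := 1) ⟨zero_le_one, le_rfl⟩ using 2 with u
    simp only [Associahedron.toSimplex_center]
    refine (isConcatenation_concatPath hX _ _).unique (isConcatenation_pair (fun t ht => ?_)
      fun t ht => ?_)
    · exact u.apply_of_nonpos (by linarith)
    · simp [PathSpace.squeeze]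
  right_unit := by
    convert smoothlyHomotopic_squeeze (X := X) (e := 0) ⟨le_rfl, zero_le_one⟩ using 2 with u
    simp only [Associahedron.toSimplex_center]
    refine (isConcatenation_concatPath hX _ _).unique (isConcatenation_pair (fun t ht => ?_)
      fun t ht => ?_)
    · simp [PathSpace.squeeze]
    · exact u.apply_of_one_le (by linarith)

end Paths

end

end AInfty

theorem mainTheorem1 {X : Type*} [DiffeologicalSpace X] (hX : IsReflexive X) :
    IsDiffeomorphism
      (PathSpace.ofInterval : SmoothMap Interval X → PathSpace X) ∧
    ∃ (β : (n : ℕ) → OpenSimplex n × Composable (pathPrecategory X) n →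
          PathSpace X)
      (φ : (n : ℕ) → Associahedron n → OpenSimplex n),
      (∀ n, 2 ≤ n → DSmooth (β n)) ∧
      (∀ n, 2 ≤ n → ∀ (r : OpenSimplex n)
        (u : Composable (pathPrecategory X) n),
        IsConcatenation r u (β n (r, u))) ∧
      (∀ n, 2 ≤ n → DSmooth (φ n)) ∧
      (∀ (n : ℕ) (hn : 2 ≤ n),
        φ n (Associahedron.center n hn) = OpenSimplex.barycenter n hn) ∧
      (∀ (r s n : ℕ) (h : r + s = n + 1) (hr : 2 ≤ r) (hs : 2 ≤ s) (k : Fin r)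
        (ρ : Associahedron r) (σ : Associahedron s),
        (φ n (Associahedron.face h hr hs k ρ σ)).val =
          simplexFaceMap h hs k (φ r ρ).val (φ s σ).val) ∧
      IsHUnitalAInftyForm (pathPrecategory X)
        (fun n z => β n (φ n z.1, z.2)) :=
  ⟨isDiffeomorphism_ofInterval, fun _ z => concatPath hX z.1 z.2, fun _ => Associahedron.toSimplex,
    fun n _ => dSmooth_concatPath hX n, fun _ _ => isConcatenation_concatPath hX,
    fun n _ => Associahedron.dSmooth_toSimplex n, fun _ => Associahedron.toSimplex_center,
    fun _ _ _ => Associahedron.toSimplex_face, isHUnitalAInftyForm_concatPath hX⟩
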